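/- **Setting.** For every security parameter $\lambda$ let the finite group $G=G_\lambda$ act on the finite set $S=S_\lambda$ (action written $\star$), and let $s_0\in S$ be a fixed public origin. Elements are represented by bit-strings of length polynomial in $\lambda$; an element may have several representations, and each $s\in S$ has a canonical one. The action is an *effective group action* (EGA) if there are efficient classical algorithms (circuits of size polynomial in $\lambda$) for: membership and equality testing, sampling from a distribution statistically close to uniform, multiplication and inversion in $G$; membership testing and computing the canonical representation in $S$; and computing $g\star s$ from $g$ and $s$. Elements of $S$ are always given to an adversary by their canonical representations. $D\approx_c D'$ means that every quantum polynomial-time adversary (polynomial-size family of quantum circuits, i.e. non-uniform) distinguishes $D$ from $D'$ with at most negligible advantage; $x\gets X$ means uniform sampling; all samples are independent. The EGA is called * PR if $(s_0,g\star s_0)_{g\gets G}\approx_c(s_0,s_1)_{s_1\gets S}$; * wPR if for every polynomial $Q=Q(\lambda)$, $\{(s_i,g\star s_i)\}_{i\in[Q]}\approx_c\{(s_i,s_i')\}_{i\in[Q]}$ with $g\gets G$ and $s_i,s_i'\gets S$; * DDH if $(s_0,\tilde g\star s_0,g\star s_0,(\tilde g g)\star s_0)\approx_c(s_0,\tilde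 g\star s_0,g\star s_0,h\star s_0)$ with $\tilde g,g,h\gets G$; * NR if for every polynomial $Q=Q(\lambda)$, $\{(g_i\star s_0,(\tilde g g_i)\star s_0)\}_{i\in[Q]}\approx_c\{(g_i\star s_0,h_i\star s_0)\}_{i\in[Q]}$ with $\tilde g,g_i,h_i\gets G$. For $\ell=\ell(\lambda)$ bounded by a polynomial, a key $(g_0,\dots,g_\ell)\in G^{\ell+1}$ and $x\in\{0,1\}^\ell$ put $$f_{g_0,\dots,g_\ell}(x)=(g_\ell^{x_\ell}\cdots g_1^{x_1}g_0)\star s_0 .$$ We say that $f$ is a PRF if every (non-uniform) quantum polynomial-time adversary with classical query access to an oracle distinguishes $f_{g_0,\dots,g_\ell}$ with $g_0,\dots,g_\ell\gets G$ from a uniformly random function $\{0,1\}^\ell\to S$ with at most negligible advantage. **Theorem.** Let $(G,S,\star)$ be an EGA. 1. If it is PR and NR, then $f$ is a PRF. 2. If $G$ is commutative and the EGA is PR and DDH, then $f$ is a PRF. 3. If the EGA is PR and wPR, then $f$ is a PRF. 4. If the EGA is wPR and the action is transitive and faithful, then $f$ is a PRF. -/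

import Mathlib

open scoped BigOperators

noncomputable section

namespace NRPRF

universe u v w

/-! ### Asymptotics -/

/-- `f` is bounded by a polynomial in the security parameter. -/
def PolyBounded (f : ℕ → ℕ) : Prop :=
  ∃ p : Polynomial ℕ, ∀ n, f n ≤ p.eval n

/-- `f` is negligible: it decays faster than every inverse polynomial. -/
def Negligible (f : ℕ → ℝ) : Prop :=
  Asymptotics.SuperpolynomialDecay Filter.atTop (fun n : ℕ => (n : ℝ)) f

/-! ### Boolean circuits -/

/-- A classical memory: an unbounded array of bits. A program touches only as many of them as it
has steps, up to a constant factor; all cells not set by the input are `false` initially. -/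
abbrev Mem := ℕ → Bool

/-- The memory whose first cells hold the given bit-string. -/
def Mem.load (x : List Bool) : Mem := fun i => x.getD i false

/-- The NAND gate that writes `¬ (src₁ ∧ src₂)` to the cell `dst`. -/
structure NandGate where
  dst : ℕ
  src₁ : ℕ
  src₂ : ℕ

def NandGate.apply (g : NandGate) (c : Mem) : Mem :=
  Function.update c g.dst (!(c g.src₁ && c g.src₂))

/-- A Boolean circuit with `m` output bits, as a straight-line program of NAND gates. -/
structure BoolCircuit (m : ℕ) where
  gates : List NandGate
  outs : Fin m → ℕ

/-- The output of a circuit on an input string. -/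
def BoolCircuit.eval {m : ℕ} (C : BoolCircuit m) (x : List Bool) : Fin m → Bool :=
  fun j => C.gates.foldl (fun c g => g.apply c) (Mem.load x) (C.outs j)

/-- A family of Boolean circuits of polynomial size. -/
def PolyCircuits {m : ℕ → ℕ} (C : ∀ n, BoolCircuit (m n)) : Prop :=
  PolyBounded fun n => (C n).gates.length + m n

/-! ### Quantum programs with classical memory -/

/-- Instructions of a quantum circuit on `m` qubits with classical control: Boolean gates on the
classical memory, the gates `H`, `T`, `CNOT` on the qubits, the Pauli gate `X` controlled by
a classical bit, and the measurement of a qubit in the computational basis. -/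
inductive Instr (m : ℕ) where
  | classical (g : NandGate)
  | hadamard (i : Fin m)
  | tGate (i : Fin m)
  | cnot (control target : Fin m) (h : control ≠ target)
  | flipIf (i : Fin m) (b : ℕ)
  | measure (i : Fin m) (b : ℕ)

/-- One branch of a computation: the classical memory and the (unnormalized) quantum state, whose
squared norm is the probability of the branch. -/
structure Config (m : ℕ) where
  mem : Mem
  amp : (Fin m → Bool) → ℂ

/-- The probability of a branch. -/
def Config.weight {m : ℕ} (c : Config m) : ℝ := ∑ x, ‖c.amp x‖ ^ 2

/-- Memory `mem`, all qubits in the state `|0⟩`. -/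
def Config.init (m : ℕ) (mem : Mem) : Config m :=
  ⟨mem, fun x => if x = (fun _ => false) then 1 else 0⟩

/-- The branches that a configuration has after one instruction. -/
def Instr.step {m : ℕ} : Instr m → Config m → List (Config m)
  | .classical g, c => [⟨g.apply c.mem, c.amp⟩]
  | .hadamard i, c =>
      [⟨c.mem, fun x =>
        (c.amp (Function.update x i false) +
          (if x i then -1 else 1) * c.amp (Function.update x i true)) / (Real.sqrt 2 : ℂ)⟩]
  | .tGate i, c =>
      [⟨c.mem, fun x =>
        (if x i then Complex.exp (Real.pi / 4 * Complex.I) else 1) * c.amp x⟩]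
  | .cnot i j _, c => [⟨c.mem, fun x => c.amp (Function.update x j (x j ^^ x i))⟩]
  | .flipIf i b, c => [⟨c.mem, fun x => c.amp (Function.update x i (x i ^^ c.mem b))⟩]
  | .measure i b, c =>
      [⟨Function.update c.mem b false, fun x => if x i = false then c.amp x else 0⟩,
       ⟨Function.update c.mem b true, fun x => if x i = true then c.amp x else 0⟩]

/-- Instructions of a program with an oracle taking `a` input bits: a query sends the classical bits
in the cells `ins` and stores the answer in the consecutive cells starting at `out`. -/
inductive OracleInstr (m a : ℕ) where
  | plain (i : Instr m)
  | query (ins : Fin a → ℕ) (out : ℕ)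

/-- Overwrite the cells `out, …, out + b - 1`. -/
def Mem.write {b : ℕ} (c : Mem) (out : ℕ) (y : Fin b → Bool) : Mem := fun p =>
  if h : out ≤ p ∧ p < out + b then y ⟨p - out, by omega⟩ else c p

def OracleInstr.step {m a b : ℕ} (O : (Fin a → Bool) → (Fin b → Bool)) :
    OracleInstr m a → Config m → List (Config m)
  | .plain i, c => i.step c
  | .query ins out, c => [⟨c.mem.write out (O fun k => c.mem (ins k)), c.amp⟩]

/-- All branches of a program. -/
def runProg {ι : Type*} {m : ℕ} (step : ι → Config m → List (Config m)) :
    List ι → Config m → List (Config m)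
  | [], c => [c]
  | i :: p, c => (step i c).flatMap (runProg step p)

/-- The probability that the cell `0` holds `1` at the end. -/
def acceptProb {m : ℕ} (branches : List (Config m)) : ℝ :=
  (branches.map fun c => if c.mem 0 then c.weight else 0).sum

/-- A quantum circuit that decides a classical input string. -/
structure Distinguisher where
  qubits : ℕ
  prog : List (Instr qubits)

/-- The probability of the output `1` on input `x`. -/
def Distinguisher.accept (A : Distinguisher) (x : List Bool) : ℝ :=
  acceptProb (runProg Instr.step A.prog (Config.init A.qubits (Mem.load x)))

def Distinguisher.size (A : Distinguisher) : ℕ := A.qubits + A.prog.length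

/-- A quantum circuit with classical access to an oracle on `a`-bit strings. -/
structure OracleDistinguisher (a : ℕ) where
  qubits : ℕ
  prog : List (OracleInstr qubits a)

/-- The probability of the output `1` with the oracle `O`. -/
def OracleDistinguisher.accept {a b : ℕ} (A : OracleDistinguisher a)
    (O : (Fin a → Bool) → (Fin b → Bool)) : ℝ :=
  acceptProb (runProg (OracleInstr.step O) A.prog (Config.init A.qubits (Mem.load [])))

def OracleDistinguisher.size {a : ℕ} (A : OracleDistinguisher a) : ℕ :=
  A.qubits + A.prog.length

/-! ### Indistinguishability

Random variables are functions of a uniformly random element of a finite set. -/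

open Classical in
/-- Statistical distance of two random variables with values in a finite set. -/
def statDist {Ω : Type u} {Ω' : Type v} {α : Type w} [Fintype Ω] [Fintype Ω'] [Fintype α]
    (X : Ω → α) (Y : Ω' → α) : ℝ :=
  (1 / 2) * ∑ a, |(𝔼 ω, if X ω = a then (1 : ℝ) else 0) - 𝔼 ω, if Y ω = a then (1 : ℝ) else 0|

/-- Computational indistinguishability of two ensembles of random bit-strings, with respect to
(non-uniform) quantum polynomial-time adversaries. -/
def CompIndist {Ω : ℕ → Type u} {Ω' : ℕ → Type v} [∀ n, Fintype (Ω n)] [∀ n, Fintype (Ω' n)]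
    (X : ∀ n, Ω n → List Bool) (Y : ∀ n, Ω' n → List Bool) : Prop :=
  ∀ A : ℕ → Distinguisher, PolyBounded (fun n => (A n).size) →
    Negligible fun n => |(𝔼 ω, (A n).accept (X n ω)) - 𝔼 ω, (A n).accept (Y n ω)|

/-- Computational indistinguishability of two ensembles of random functions from `a n`-bit strings
to `b n`-bit strings, given as oracles to (non-uniform) quantum polynomial-time adversaries that
make classical queries. -/
def OracleIndist {a b : ℕ → ℕ} {Ω : ℕ → Type u} {Ω' : ℕ → Type v}
    [∀ n, Fintype (Ω n)] [∀ n, Fintype (Ω' n)]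
    (F : ∀ n, Ω n → (Fin (a n) → Bool) → (Fin (b n) → Bool))
    (F' : ∀ n, Ω' n → (Fin (a n) → Bool) → (Fin (b n) → Bool)) : Prop :=
  ∀ A : ∀ n, OracleDistinguisher (a n), PolyBounded (fun n => (A n).size) →
    Negligible fun n => |(𝔼 ω, (A n).accept (F n ω)) - 𝔼 ω, (A n).accept (F' n ω)|

/-! ### Effective group actions -/

section EGA

variable (G : ℕ → Type u) (S : ℕ → Type v) [∀ n, Group (G n)] [∀ n, MulAction (G n) (S n)]
  [∀ n, Fintype (G n)] [∀ n, Fintype (S n)]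

/-- An effective group action: for each security parameter `n`, the finite group `G n` acts on the
finite set `S n`; elements are represented by bit-strings of polynomial length (an element may have
several representations), with efficient algorithms for the basic operations. -/
structure EGA where
  gLen : ℕ → ℕ
  sLen : ℕ → ℕ
  gLen_poly : PolyBounded gLen
  sLen_poly : PolyBounded sLen
  /-- The group element represented by a string, if any. -/
  decG : ∀ n, (Fin (gLen n) → Bool) → Option (G n)
  decG_surj : ∀ n (g : G n), ∃ x, decG n x = some g
  /-- The set element represented by a string, if any. -/
  decS : ∀ n, (Fin (sLen n) → Bool) → Option (S n)
  /-- The canonical representation of a set element. -/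
  canon : ∀ n, S n → (Fin (sLen n) → Bool)
  decS_canon : ∀ n (s : S n), decS n (canon n s) = some s
  /-- The origin. -/
  origin : ∀ n, S n
  memberG : ∃ C : ∀ _ : ℕ, BoolCircuit 1, PolyCircuits C ∧
    ∀ n x, (C n).eval (List.ofFn x) 0 = true ↔ ∃ g, decG n x = some g
  equalG : ∃ C : ∀ _ : ℕ, BoolCircuit 1, PolyCircuits C ∧
    ∀ n x y, (C n).eval (List.ofFn x ++ List.ofFn y) 0 = true ↔
      ∃ g, decG n x = some g ∧ decG n y = some g
  /-- Sampling from a distribution statistically close to uniform, using `r n` random bits. -/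
  sampleG : ∃ (r : ℕ → ℕ) (C : ∀ n, BoolCircuit (gLen n)), PolyBounded r ∧ PolyCircuits C ∧
    Negligible fun n =>
      statDist (fun ω : Fin (r n) → Bool => decG n ((C n).eval (List.ofFn ω)))
        (fun g : G n => some g)
  mulG : ∃ C : ∀ n, BoolCircuit (gLen n), PolyCircuits C ∧
    ∀ n x y g h, decG n x = some g → decG n y = some h →
      decG n ((C n).eval (List.ofFn x ++ List.ofFn y)) = some (g * h)
  invG : ∃ C : ∀ n, BoolCircuit (gLen n), PolyCircuits C ∧
    ∀ n x g, decG n x = some g → decG n ((C n).eval (List.ofFn x)) = some g⁻¹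
  memberS : ∃ C : ∀ _ : ℕ, BoolCircuit 1, PolyCircuits C ∧
    ∀ n x, (C n).eval (List.ofFn x) 0 = true ↔ ∃ s, decS n x = some s
  canonS : ∃ C : ∀ n, BoolCircuit (sLen n), PolyCircuits C ∧
    ∀ n x s, decS n x = some s → (C n).eval (List.ofFn x) = canon n s
  act : ∃ C : ∀ n, BoolCircuit (sLen n), PolyCircuits C ∧
    ∀ n x y g s, decG n x = some g → decS n y = some s →
      decS n ((C n).eval (List.ofFn x ++ List.ofFn y)) = some (g • s)

end EGA

namespace EGA

variable {G : ℕ → Type u} {S : ℕ → Type v} [∀ n, Group (G n)] [∀ n, MulAction (G n) (S n)]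
  [∀ n, Fintype (G n)] [∀ n, Fintype (S n)] (E : EGA G S)

/-- The bit-string that represents a list of set elements. -/
def enc (n : ℕ) (L : List (S n)) : List Bool := L.flatMap fun s => List.ofFn (E.canon n s)

/-- Pseudorandomness. -/
def PR : Prop :=
  CompIndist
    (fun n (g : G n) => E.enc n [E.origin n, g • E.origin n])
    (fun n (s : S n) => E.enc n [E.origin n, s])

/-- Weak pseudorandomness. -/
def WPR : Prop :=
  ∀ Q : Polynomial ℕ,
    CompIndist
      (fun n (ω : G n × (Fin (Q.eval n) → S n)) =>
        E.enc n (List.ofFn fun i => [ω.2 i, ω.1 • ω.2 i]).flatten)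
      (fun n (ω : (Fin (Q.eval n) → S n) × (Fin (Q.eval n) → S n)) =>
        E.enc n (List.ofFn fun i => [ω.1 i, ω.2 i]).flatten)

/-- The decisional Diffie-Hellman assumption. -/
def DDH : Prop :=
  CompIndist
    (fun n (ω : G n × G n) => E.enc n
      [E.origin n, ω.1 • E.origin n, ω.2 • E.origin n, (ω.1 * ω.2) • E.origin n])
    (fun n (ω : G n × G n × G n) => E.enc n
      [E.origin n, ω.1 • E.origin n, ω.2.1 • E.origin n, ω.2.2 • E.origin n])

/-- The Naor-Reingold assumption. -/
def NR : Prop :=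
  ∀ Q : Polynomial ℕ,
    CompIndist
      (fun n (ω : G n × (Fin (Q.eval n) → G n)) =>
        E.enc n (List.ofFn fun i =>
          [ω.2 i • E.origin n, (ω.1 * ω.2 i) • E.origin n]).flatten)
      (fun n (ω : (Fin (Q.eval n) → G n) × (Fin (Q.eval n) → G n)) =>
        E.enc n (List.ofFn fun i => [ω.1 i • E.origin n, ω.2 i • E.origin n]).flatten)

/-- The function `x ↦ (g_ℓ ^ x_ℓ * ⋯ * g_1 ^ x_1 * g_0) • s₀` with key `g = (g_0, …, g_ℓ)`;
the bit `x_{i+1}` is `x i`. -/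
def nrFun (n : ℕ) {l : ℕ} (g : Fin (l + 1) → G n) (x : Fin l → Bool) : S n :=
  ((List.ofFn fun i : Fin l => g i.succ ^ (x i).toNat).reverse.prod * g 0) • E.origin n

/-- The Naor-Reingold function on `l n`-bit inputs, with uniformly random key, is
indistinguishable from a uniformly random function to `S n`. -/
def IsPRF (l : ℕ → ℕ) : Prop :=
  OracleIndist (a := l)
    (fun n (g : Fin (l n + 1) → G n) x => E.canon n (E.nrFun n g x))
    (fun n (f : (Fin (l n) → Bool) → S n) x => E.canon n (f x))

end EGA

end NRPRF

end

open NRPRF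

open scoped BigOperators

/-! Everything rests on the implication from PR and NR to PRF (`EGA.IsPRF.of_NR`), a hybrid argument
over the bit positions. In the hybrid `H j` a uniformly random function `R` assigns a group element
to each prefix of `j` bits, and the remaining factors act on `R (mask j x) • s₀` (`EGA.tailAct`). `H
0` is the Naor-Reingold function, because a function of the empty prefix is just the key element
`g_0`. In `H l` distinct inputs receive independent elements `g • s₀`, which PR turns into uniform
set elements (`EGA.PR.multi`). Between `H j` and `H (j + 1)`, the prefix `p` followed by the next
bit gives `R p • s₀` or `(k * R p) • s₀`, with the same secret `k` for all `p`. These pairs are NR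
samples; replacing them by independent pairs amounts to a random function of `j + 1` bits
(`EGA.expect_split`).

The reduction sees only polynomially many samples. It uses one per query and reuses the sample when
a prefix recurs; lazy sampling (`expect_lazyAccept`) shows that this equals a random function on all
prefixes. The later key elements are hardwired into the circuit: by finiteness a worst choice exists
at each security parameter, and adversaries are non-uniform (`CompIndist.uniform`).

The other assumptions reduce to NR. For commutative groups DDH implies NR by a hybrid over the
samples (`EGA.NR.of_DDH`). From wPR, the elements `g_i • s₀` are exchanged for uniform ones by PR
(`EGA.NR.of_WPR`). Transitivity gives PR with advantage zero (`EGA.PR.of_isPretransitive`).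

The first half of the proof builds these reductions as actual programs. Costs are counted for
abstract NAND computations (`Comp`), which are turned into gate lists once, in `Comp.exists_assign`;
`OracleDistinguisher.exists_sim` then replaces an oracle by a table. -/

namespace NRPRF

/-! ### Straight-line computations

Circuits are handled semantically: a straight-line computation enlarges a set of Boolean functions
of some input by NANDs of its members. -/

section StraightLine

variable {X : Type*} {ι κ : Type*}

/-- `StraightLine B k C`: the set `C` of functions arises from `B` by at most `k` NAND gates. -/
inductive StraightLine (B : Set (X → Bool)) : ℕ → Set (X → Bool) → Prop
  | base : StraightLine B 0 B
  | skip {k C} : StraightLine B k C → StraightLine B (k + 1) C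
  | gate {k C p q} : StraightLine B k C → p ∈ C → q ∈ C →
      StraightLine B (k + 1) (insert (fun x => !(p x && q x)) C)

theorem StraightLine.subset {B C : Set (X → Bool)} {k : ℕ} (h : StraightLine B k C) : B ⊆ C := by
  induction h with
  | base => exact subset_rfl
  | skip _ ih => exact ih
  | gate _ _ _ ih => exact ih.trans (Set.subset_insert _ _)

theorem StraightLine.append {B C D : Set (X → Bool)} {k k' : ℕ} (h : StraightLine B k C)
    (h' : StraightLine C k' D) : StraightLine B (k + k') D := by
  induction h' with
  | base => exact h
  | skip _ ih => exact ih.skip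
  | gate _ hp hq ih => exact ih.gate hp hq

theorem StraightLine.mono {B B' C : Set (X → Bool)} {k : ℕ} (h : StraightLine B k C)
    (hB : B ⊆ B') : ∃ C', StraightLine B' k C' ∧ C ⊆ C' := by
  induction h with
  | base => exact ⟨B', .base, hB⟩
  | skip _ ih =>
    obtain ⟨C', h1, h2⟩ := ih
    exact ⟨C', h1.skip, h2⟩
  | gate _ hp hq ih =>
    obtain ⟨C', h1, h2⟩ := ih
    exact ⟨_, h1.gate (h2 hp) (h2 hq), Set.insert_subset_insert h2⟩

theorem StraightLine.mono_size {B C : Set (X → Bool)} {k k' : ℕ} (h : StraightLine B k C)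
    (hk : k ≤ k') : StraightLine B k' C := by
  induction hk with
  | refl => exact h
  | step _ ih => exact ih.skip

/-- All bits of `f` belong to `B`. -/
def BitsIn (B : Set (X → Bool)) (f : X → ι → Bool) : Prop := ∀ j, (fun x => f x j) ∈ B

theorem BitsIn.mono {B B' : Set (X → Bool)} {f : X → ι → Bool} (h : BitsIn B f) (hB : B ⊆ B') :
    BitsIn B' f := fun j => hB (h j)

/-- All bits of `f` can be computed from `B` by at most `k` NAND gates. -/
def Comp (B : Set (X → Bool)) (k : ℕ) (f : X → ι → Bool) : Prop :=
  ∃ C, StraightLine B k C ∧ BitsIn C f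

variable {B : Set (X → Bool)} {k k' : ℕ}

theorem Comp.of_mem {f : X → ι → Bool} (h : BitsIn B f) : Comp B 0 f := ⟨B, .base, h⟩

theorem Comp.mono {B' : Set (X → Bool)} {f : X → ι → Bool} (h : Comp B k f) (hB : B ⊆ B') :
    Comp B' k f := by
  obtain ⟨C, h1, h2⟩ := h
  obtain ⟨C', h3, h4⟩ := h1.mono hB
  exact ⟨C', h3, h2.mono h4⟩

theorem Comp.mono_size {f : X → ι → Bool} (h : Comp B k f) (hk : k ≤ k') : Comp B k' f := by
  obtain ⟨C, h1, h2⟩ := h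
  exact ⟨C, h1.mono_size hk, h2⟩

/-- The continuation is quantified over all larger sets `B'`, so it may use the bits of `f` without
knowing which intermediate functions were added. -/
theorem Comp.bind {f : X → ι → Bool} {h : X → κ → Bool} (hf : Comp B k f)
    (hh : ∀ B', B ⊆ B' → BitsIn B' f → Comp B' k' h) : Comp B (k + k') h := by
  obtain ⟨C, h1, h2⟩ := hf
  obtain ⟨D, h3, h4⟩ := hh C h1.subset h2
  exact ⟨D, h1.append h3, h4⟩

theorem Comp.gate {f : X → ι → Bool} {p q : X → Bool} (hp : p ∈ B) (hq : q ∈ B)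
    (h : Comp (insert (fun x => !(p x && q x)) B) k f) : Comp B (k + 1) f := by
  obtain ⟨C, h1, h2⟩ := h
  exact ⟨C, add_comm 1 k ▸ (StraightLine.base.gate hp hq).append h1, h2⟩

theorem Comp.reindex {f : X → ι → Bool} (h : Comp B k f) (σ : κ → ι) :
    Comp B k fun x j => f x (σ j) := by
  obtain ⟨C, h1, h2⟩ := h
  exact ⟨C, h1, fun j => h2 (σ j)⟩

theorem Comp.pi [Fintype ι] {f : X → ι → κ → Bool} (h : ∀ i, Comp B k fun x => f x i) :
    Comp B (Fintype.card ι * k) fun x (p : ι × κ) => f x p.1 p.2 := by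
  classical
  suffices H : ∀ s : Finset ι, ∃ C, StraightLine B (s.card * k) C ∧
      ∀ i ∈ s, BitsIn C fun x => f x i by
    obtain ⟨C, h1, h2⟩ := H Finset.univ
    exact ⟨C, h1, fun p => h2 p.1 (Finset.mem_univ _) p.2⟩
  intro s
  induction s using Finset.induction_on with
  | empty => exact ⟨B, by simpa using StraightLine.base, by simp⟩
  | insert a s ha ih =>
    obtain ⟨C, h1, h2⟩ := ih
    obtain ⟨D, h3, h4⟩ := (h a).mono h1.subset
    refine ⟨D, ?_, ?_⟩
    · rw [Finset.card_insert_of_notMem ha, Nat.succ_mul]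
      exact h1.append h3
    · intro i hi
      rcases Finset.mem_insert.1 hi with rfl | hi
      · exact h4
      · exact (h2 i hi).mono h3.subset

theorem Comp.bits [Fintype ι] {f : X → ι → Bool} (h : ∀ i, Comp B k fun x (_ : Unit) => f x i) :
    Comp B (Fintype.card ι * k) f :=
  (Comp.pi (f := fun x i (_ : Unit) => f x i) h).reindex fun i => (i, ())

/-- The NAND of `p` and its negation is constantly true, and one more negation gives false. Any
available function thus provides the constants. -/
theorem Comp.const_false (hB : B.Nonempty) : Comp B 3 fun (_ : X) (_ : Unit) => false := by
  obtain ⟨p, hp⟩ := hB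
  refine .gate hp hp (.gate (p := p) (q := fun x => !(p x && p x)) (by simp [hp]) (by simp)
    (.gate (p := fun x => !(p x && !(p x && p x))) (q := fun x => !(p x && !(p x && p x)))
      (by simp) (by simp) (.of_mem fun _ => Or.inl (funext fun x => ?_))))
  cases p x <;> rfl

theorem Comp.const (hB : (fun _ => false) ∈ B) (v : ι → Bool) :
    Comp B 1 fun (_ : X) => v := by
  refine .gate hB hB (.of_mem fun j => ?_)
  cases h : v j
  · exact Or.inr (by simpa [h] using hB)
  · exact Or.inl (by simp)

theorem Comp.mux_bit {s a b : X → Bool} (hs : s ∈ B) (ha : a ∈ B) (hb : b ∈ B) :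
    Comp B 4 fun x (_ : Unit) => if s x then a x else b x := by
  refine .gate hs hs (.gate (p := s) (q := a) (by simp [hs]) (by simp [ha])
    (.gate (p := fun x => !(s x && s x)) (q := b) (by simp) (by simp [hb])
    (.gate (p := fun x => !(s x && a x)) (q := fun x => !((!(s x && s x)) && b x))
      (by simp) (by simp) (.of_mem fun _ => Or.inl (funext fun x => ?_)))))
  cases s x <;> simp

theorem Comp.mux [Fintype ι] {s : X → Bool} {f g : X → ι → Bool} (hs : s ∈ B) (hf : BitsIn B f)
    (hg : BitsIn B g) : Comp B (Fintype.card ι * 4) fun x => if s x then f x else g x := by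
  refine .bits fun i => ?_
  have := Comp.mux_bit hs (hf i) (hg i)
  convert this using 3
  split_ifs <;> rfl

/-- Four NANDs give the exclusive or, a fifth negates it, and two more form the conjunction with
`r`. -/
theorem Comp.xnor_and {a b r : X → Bool} (ha : a ∈ B) (hb : b ∈ B) (hr : r ∈ B) :
    Comp B 7 fun x (_ : Unit) => (a x == b x) && r x := by
  refine .gate ha hb (.gate (p := a) (q := fun x => !(a x && b x)) (by simp [ha]) (by simp)
    (.gate (p := b) (q := fun x => !(a x && b x)) (by simp [hb]) (by simp)
    (.gate (p := fun x => !(a x && !(a x && b x))) (q := fun x => !(b x && !(a x && b x)))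
      (by simp) (by simp)
    (.gate (p := fun x => !(!(a x && !(a x && b x)) && !(b x && !(a x && b x))))
      (q := fun x => !(!(a x && !(a x && b x)) && !(b x && !(a x && b x)))) (by simp) (by simp)
    (.gate (p := fun x => !(!(!(a x && !(a x && b x)) && !(b x && !(a x && b x))) &&
        !(!(a x && !(a x && b x)) && !(b x && !(a x && b x))))) (q := r) (by simp) (by simp [hr])
    (.gate (p := fun x => !(!(!(!(a x && !(a x && b x)) && !(b x && !(a x && b x))) &&
        !(!(a x && !(a x && b x)) && !(b x && !(a x && b x)))) && r x))
      (q := fun x => !(!(!(!(a x && !(a x && b x)) && !(b x && !(a x && b x))) &&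
        !(!(a x && !(a x && b x)) && !(b x && !(a x && b x)))) && r x)) (by simp) (by simp)
      (.of_mem fun _ => Or.inl (funext fun x => ?_))))))))
  cases a x <;> cases b x <;> simp

theorem Comp.eq (hB : (fun _ => false) ∈ B) {m : ℕ} {f g : X → Fin m → Bool} (hf : BitsIn B f)
    (hg : BitsIn B g) : Comp B (m * 7 + 1) fun x (_ : Unit) => decide (f x = g x) := by
  induction m with
  | zero =>
    convert Comp.const hB (fun (_ : Unit) => true) using 3
    simpa using Subsingleton.elim _ _
  | succ m ih =>
    have h1 := ih (f := fun x i => f x i.succ) (g := fun x i => g x i.succ)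
      (fun j => hf j.succ) (fun j => hg j.succ)
    have h2 := h1.bind fun B' hB' hr => Comp.xnor_and (hB' (hf 0)) (hB' (hg 0)) (hr ())
    rw [show m * 7 + 1 + 7 = (m + 1) * 7 + 1 by ring] at h2
    convert h2 using 3 with x
    rw [Bool.eq_iff_iff]
    simp [funext_iff, Fin.forall_fin_succ]

theorem Comp.circuit {m : ℕ} (C : BoolCircuit m) {inp : X → List Bool}
    (h : ∀ i, (fun x => Mem.load (inp x) i) ∈ B) : Comp B C.gates.length fun x => C.eval (inp x) := by
  suffices H : ∀ (L : List NandGate) (B : Set (X → Bool)) (c : X → Mem), BitsIn B c →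
      ∃ D, StraightLine B L.length D ∧
        BitsIn D fun x => L.foldl (fun c g => g.apply c) (c x) by
    obtain ⟨D, h1, h2⟩ := H C.gates B (fun x => Mem.load (inp x)) h
    exact ⟨D, h1, fun j => h2 (C.outs j)⟩
  intro L
  induction L with
  | nil => exact fun B c hc => ⟨B, .base, hc⟩
  | cons g L ih =>
    intro B c hc
    have hg : BitsIn (insert (fun x => !(c x g.src₁ && c x g.src₂)) B) fun x => g.apply (c x) := by
      intro j
      by_cases hj : j = g.dst
      · subst hj
        exact Or.inl (by simp [NandGate.apply])
      · exact Or.inr (by simpa [NandGate.apply, hj] using hc j)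
    obtain ⟨D, h1, h2⟩ := ih _ _ hg
    refine ⟨D, ?_, h2⟩
    rw [List.length_cons, add_comm]
    exact (StraightLine.base.gate (hc _) (hc _)).append h1

theorem BitsIn.load_ofFn (hB : (fun _ => false) ∈ B) {m : ℕ} {f : X → Fin m → Bool}
    (hf : BitsIn B f) (i : ℕ) : (fun x => Mem.load (List.ofFn (f x)) i) ∈ B := by
  by_cases h : i < m
  · simpa [Mem.load, List.getD_eq_getElem?_getD, h] using hf ⟨i, h⟩
  · simpa [Mem.load, List.getD_eq_getElem?_getD, h] using hB

theorem BitsIn.append {m m' : ℕ} {f : X → Fin m → Bool} {g : X → Fin m' → Bool}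
    (hf : BitsIn B f) (hg : BitsIn B g) : BitsIn B fun x => Fin.append (f x) (g x) := by
  intro j
  refine Fin.addCases (fun i => ?_) (fun i => ?_) j
  · simpa using hf i
  · simpa using hg i

/-- A chain of equality tests and multiplexers. Since `idxOf` returns the length of the list for a
missing key, `T` needs one entry more than there are keys, and this entry is the default. -/
theorem Comp.lookup (hB : (fun _ => false) ∈ B) {m w : ℕ} {y : X → Fin m → Bool} (hy : BitsIn B y)
    (K : List (X → Fin m → Bool)) (hK : ∀ f ∈ K, BitsIn B f) (T : ℕ → X → Fin w → Bool)
    (hT : ∀ i ≤ K.length, BitsIn B (T i)) :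
    Comp B (K.length * (m * 7 + 1 + w * 4)) fun x => T ((K.map fun f => f x).idxOf (y x)) x := by
  induction K generalizing T with
  | nil => simpa using Comp.of_mem (hT 0 le_rfl)
  | cons f K ih =>
    have h1 := ih (fun g hg => hK g (by simp [hg])) (fun i => T (i + 1))
      (fun i hi => hT (i + 1) (by simpa using hi))
    have h2 := h1.bind fun B' hB' hr =>
      ((Comp.eq hB (hK f (by simp)) hy).mono hB').bind fun B'' hB'' hs =>
        Comp.mux (hs ()) ((hT 0 (by simp)).mono (hB'.trans hB'')) (hr.mono hB'')
    refine Eq.mp ?_ h2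
    congr 1
    · simp; ring
    · funext x
      simp only [List.map_cons, List.idxOf_cons, decide_eq_true_eq, cond_eq_ite, beq_iff_eq]
      split_ifs <;> rfl

end StraightLine

/-! ### Straight-line computations as programs on a memory -/

/-- The memory after a list of gates. -/
def runGates (L : List NandGate) (c : Mem) : Mem := L.foldl (fun c g => g.apply c) c

theorem runGates_append (L L' : List NandGate) (c : Mem) :
    runGates (L ++ L') c = runGates L' (runGates L c) := by
  simp [runGates]

/-- The functions that read a cell of `P`. -/
def cells (P : Set ℕ) : Set (Mem → Bool) := {f | ∃ p ∈ P, f = fun c => c p}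

/-- The gate number `i` writes to the fresh cell `fr i`, so no value computed or given earlier is
ever overwritten. -/
theorem StraightLine.realize {P : Set ℕ} {k : ℕ} {C : Set (Mem → Bool)}
    (h : StraightLine (cells P) k C) {fr : ℕ → ℕ} (hfr : fr.Injective) (hP : ∀ i, fr i ∉ P) :
    ∃ gs : List NandGate, gs.length ≤ k ∧
      (∀ c p, (∀ i, p ≠ fr i) → runGates gs c p = c p) ∧
      ∀ f ∈ C, ∃ w, (w ∈ P ∨ ∃ i < k, w = fr i) ∧ ∀ c, runGates gs c w = f c := by
  induction h with
  | base =>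
    refine ⟨[], le_rfl, fun _ _ _ => rfl, ?_⟩
    rintro f ⟨p, hp, rfl⟩
    exact ⟨p, Or.inl hp, fun _ => rfl⟩
  | skip _ ih =>
    obtain ⟨gs, h1, h2, h3⟩ := ih
    refine ⟨gs, h1.trans (Nat.le_succ _), h2, fun f hf => ?_⟩
    obtain ⟨w, hw, hw'⟩ := h3 f hf
    exact ⟨w, hw.imp_right fun ⟨i, hi, e⟩ => ⟨i, hi.trans (Nat.lt_succ_self _), e⟩, hw'⟩
  | @gate k C p q _ hp hq ih =>
    obtain ⟨gs, h1, h2, h3⟩ := ih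
    obtain ⟨wp, -, hwp⟩ := h3 p hp
    obtain ⟨wq, -, hwq⟩ := h3 q hq
    refine ⟨gs ++ [⟨fr k, wp, wq⟩], by simpa using h1, fun c p hp => ?_, fun f hf => ?_⟩
    · rw [runGates_append]
      simpa [runGates, NandGate.apply, hp k] using h2 c p hp
    · rcases hf with rfl | hf
      · refine ⟨fr k, Or.inr ⟨k, Nat.lt_succ_self _, rfl⟩, fun c => ?_⟩
        rw [runGates_append]
        simp only [← hwp, ← hwq]
        simp [runGates, NandGate.apply]
      · obtain ⟨w, hw, hw'⟩ := h3 f hf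
        have hne : w ≠ fr k := by
          rintro rfl
          rcases hw with hw | ⟨i, hi, e⟩
          · exact hP _ hw
          · exact hi.ne' (hfr e)
        refine ⟨w, hw.imp_right fun ⟨i, hi, e⟩ => ⟨i, hi.trans (Nat.lt_succ_self _), e⟩,
          fun c => ?_⟩
        rw [runGates_append, ← hw' c]
        simp [runGates, NandGate.apply, hne]

/-- Copy cells one after the other, with the auxiliary cell `t`. -/
def copyGates (t : ℕ) (L : List (ℕ × ℕ)) : List NandGate :=
  L.flatMap fun e => [⟨t, e.1, e.1⟩, ⟨e.2, t, t⟩]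

theorem length_copyGates (t : ℕ) (L : List (ℕ × ℕ)) : (copyGates t L).length = 2 * L.length := by
  induction L with
  | nil => rfl
  | cons e L ih => simp [copyGates] at ih ⊢; omega

theorem runGates_copyGates_cons (t : ℕ) (e : ℕ × ℕ) (L : List (ℕ × ℕ)) (c : Mem) :
    runGates (copyGates t (e :: L)) c = runGates (copyGates t L)
      (Function.update (Function.update c t (!(c e.1))) e.2 (c e.1)) := by
  simp [runGates, copyGates, NandGate.apply]

theorem runGates_copyGates_of_notMem {t : ℕ} {L : List (ℕ × ℕ)} (c : Mem) {p : ℕ} (hp : p ≠ t)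
    (hL : ∀ e ∈ L, p ≠ e.2) : runGates (copyGates t L) c p = c p := by
  induction L generalizing c with
  | nil => rfl
  | cons e L ih =>
    rw [runGates_copyGates_cons, ih _ fun e he => hL e (by simp [he])]
    simp [hp, hL e (by simp)]

theorem runGates_copyGates_of_mem {t : ℕ} {L : List (ℕ × ℕ)} (c : Mem)
    (hnd : (L.map Prod.snd).Nodup) (ht : ∀ e ∈ L, e.1 ≠ t ∧ e.2 ≠ t)
    (hL : ∀ e ∈ L, ∀ e' ∈ L, e.1 ≠ e'.2) {e : ℕ × ℕ} (he : e ∈ L) :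
    runGates (copyGates t L) c e.2 = c e.1 := by
  induction L generalizing c with
  | nil => simp at he
  | cons e' L ih =>
    rw [runGates_copyGates_cons]
    simp only [List.map_cons, List.nodup_cons, List.mem_map, not_exists, not_and] at hnd
    rcases List.mem_cons.1 he with rfl | he'
    · rw [runGates_copyGates_of_notMem _ (ht e he).2 fun e' he' h => hnd.1 e' he' h.symm]
      simp
    · rw [ih _ hnd.2 (fun e he => ht e (by simp [he]))
        (fun e he e' he' => hL e (by simp [he]) e' (by simp [he'])) he']
      simp [hL e he e' (by simp), (ht e he).1]

theorem runGates_copyGates_ofFn {t m : ℕ} {w d : Fin m → ℕ} (c : Mem) (hd : d.Injective)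
    (hw : ∀ i, w i ≠ t) (hdt : ∀ i, d i ≠ t) (hwd : ∀ i j, w i ≠ d j) (j : Fin m) :
    runGates (copyGates t (List.ofFn fun i => (w i, d i))) c (d j) = c (w j) := by
  refine runGates_copyGates_of_mem (e := (w j, d j)) c ?_ ?_ ?_ (List.mem_ofFn.2 ⟨j, rfl⟩)
  · rw [List.map_ofFn]
    exact List.nodup_ofFn.2 hd
  · simp only [List.mem_ofFn, forall_exists_index]
    rintro _ i rfl
    exact ⟨hw i, hdt i⟩
  · simp only [List.mem_ofFn, forall_exists_index]
    rintro _ i rfl _ i' rfl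
    exact hwd i i'

/-- A straight-line computation gives a program for a parallel assignment. -/
theorem Comp.exists_assign {P : Set ℕ} (hP : P.Nonempty) {fr : ℕ → ℕ} (hfr : fr.Injective)
    (hfrP : ∀ i, fr i ∉ P) {m k : ℕ} {d : Fin m → ℕ} (hd : d.Injective)
    (hdfr : ∀ i j, d j ≠ fr i) {f : Mem → Fin m → Bool}
    (h : Comp (insert (fun _ => false) (cells P)) k f) :
    ∃ gs : List NandGate, gs.length ≤ k + 3 + 4 * m ∧ ∀ c,
      (∀ j, runGates gs c (d j) = f c j) ∧
      ∀ p, (∀ i, p ≠ fr i) → (∀ j, p ≠ d j) → runGates gs c p = c p := by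
  have hne : (cells P).Nonempty := by
    obtain ⟨p, hp⟩ := hP
    exact ⟨_, p, hp, rfl⟩
  obtain ⟨C, hC, hf⟩ := (Comp.const_false hne).bind fun B' hB' h0 =>
    h.mono (Set.insert_subset (h0 ()) hB')
  obtain ⟨gs, h1, h2, h3⟩ := hC.realize hfr hfrP
  choose w hw hw' using fun j => h3 _ (hf j)
  -- The destinations may also be sources, so the results are first copied to the fresh cells `mid`
  -- and only then moved to `d`. Each copy is a double negation through `t`, which accounts for `4 *
  -- m`; the summand `3` pays for the constant false.
  set t := fr (3 + k) with ht
  set mid : Fin m → ℕ := fun j => fr (3 + k + 1 + j) with hmid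
  have hmi : mid.Injective := fun i j e => Fin.ext (by have := hfr e; omega)
  have hmt : ∀ j, mid j ≠ t := fun j e => by have := hfr e; omega
  have hwt : ∀ j, w j ≠ t := by
    intro j e
    rcases hw j with h | ⟨i, hi, e'⟩
    · exact hfrP _ (e ▸ h)
    · have := hfr (e'.symm.trans e); omega
  have hwm : ∀ i j, w i ≠ mid j := by
    intro j j' e
    rcases hw j with h | ⟨i, hi, e'⟩
    · exact hfrP _ (e ▸ h)
    · have := hfr (e'.symm.trans e); omega
  refine ⟨gs ++ (copyGates t (List.ofFn fun i => (w i, mid i)) ++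
    copyGates t (List.ofFn fun i => (mid i, d i))), ?_, fun c => ⟨fun j => ?_, fun p hp hpd => ?_⟩⟩
  · simp only [List.length_append, length_copyGates, List.length_ofFn]
    omega
  · rw [runGates_append, runGates_append,
      runGates_copyGates_ofFn _ hd hmt (fun i => hdfr _ i) (fun i j e => hdfr _ _ e.symm),
      runGates_copyGates_ofFn _ hmi hwt hmt hwm, hw']
  · rw [runGates_append, runGates_append, runGates_copyGates_of_notMem, runGates_copyGates_of_notMem,
      h2 _ _ hp]
    · exact hp _
    · simp only [List.mem_ofFn, forall_exists_index]
      rintro _ i rfl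
      exact hp _
    · exact hp _
    · simp only [List.mem_ofFn, forall_exists_index]
      rintro _ i rfl
      exact hpd i

/-! ### Simulation of programs -/

theorem Mem.load_of_length_le {x : List Bool} {i : ℕ} (h : x.length ≤ i) :
    Mem.load x i = false := by
  simp [Mem.load, List.getD_eq_getElem?_getD, List.getElem?_eq_none h]

theorem acceptProb_flatMap {ι : Type*} {m : ℕ} (L : List ι) (f : ι → List (Config m)) :
    acceptProb (L.flatMap f) = (L.map fun i => acceptProb (f i)).sum := by
  induction L with
  | nil => simp [acceptProb]
  | cons i L ih => simp [acceptProb] at ih ⊢; rw [ih]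

theorem acceptProb_runProg_cons {ι : Type*} {m : ℕ} (step : ι → Config m → List (Config m)) (i : ι)
    (p : List ι) (c : Config m) : acceptProb (runProg step (i :: p) c) =
      ((step i c).map fun c' => acceptProb (runProg step p c')).sum :=
  acceptProb_flatMap _ _

theorem acceptProb_runProg_nil {ι : Type*} {m : ℕ} (step : ι → Config m → List (Config m))
    (c : Config m) :
    acceptProb (runProg step [] c) = if c.mem 0 then c.weight else 0 := by
  simp [acceptProb, runProg]

theorem runProg_classical_append {m : ℕ} (gs : List NandGate) (p : List (Instr m)) (c : Config m) :
    runProg Instr.step (gs.map Instr.classical ++ p) c =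
      runProg Instr.step p ⟨runGates gs c.mem, c.amp⟩ := by
  induction gs generalizing c with
  | nil => rfl
  | cons g gs ih => simp [runProg, Instr.step, ih, runGates]

/-- An instruction with its classical cells renamed. -/
def Instr.rename {m : ℕ} (ρ : ℕ → ℕ) : Instr m → Instr m
  | .classical g => .classical ⟨ρ g.dst, ρ g.src₁, ρ g.src₂⟩
  | .hadamard i => .hadamard i
  | .tGate i => .tGate i
  | .cnot i j h => .cnot i j h
  | .flipIf i b => .flipIf i (ρ b)
  | .measure i b => .measure i (ρ b)

/-- `d` holds the configuration `c` in the cells `ρ 0, ρ 1, …`. -/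
def Holds {m : ℕ} (ρ : ℕ → ℕ) (c d : Config m) : Prop :=
  d.amp = c.amp ∧ ∀ p, d.mem (ρ p) = c.mem p

theorem update_rename {ρ : ℕ → ℕ} (hρ : ρ.Injective) {c d : Mem} (h : ∀ p, d (ρ p) = c p) (q : ℕ)
    (v : Bool) : (∀ p, Function.update d (ρ q) v (ρ p) = Function.update c q v p) ∧
      ∀ p, (∀ i, p ≠ ρ i) → Function.update d (ρ q) v p = d p := by
  refine ⟨fun p => ?_, fun p hp => by simp [hp q]⟩
  by_cases hpq : p = q
  · simp [hpq]
  · simp [hpq, hρ.ne hpq, h]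

/-- Branches correspond one to one. That cells outside the range of `ρ` do not change protects the
table and the saved queries during a simulation. -/
theorem Holds.step {m : ℕ} {ρ : ℕ → ℕ} (hρ : ρ.Injective) {c d : Config m} (h : Holds ρ c d)
    (i : Instr m) :
    List.Forall₂ (fun c' d' => Holds ρ c' d' ∧ ∀ p, (∀ i, p ≠ ρ i) → d'.mem p = d.mem p)
      (i.step c) ((i.rename ρ).step d) := by
  obtain ⟨ha, hm⟩ := h
  cases i with
  | classical g =>
    have := update_rename hρ hm g.dst (!(c.mem g.src₁ && c.mem g.src₂))
    simpa [Instr.step, Instr.rename, Holds, NandGate.apply, hm, ha] using this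
  | hadamard i => simp [Instr.step, Instr.rename, Holds, hm, ha]
  | tGate i => simp [Instr.step, Instr.rename, Holds, hm, ha]
  | cnot i j hij => simp [Instr.step, Instr.rename, Holds, hm, ha]
  | flipIf i b => simp [Instr.step, Instr.rename, Holds, hm, ha]
  | measure i b =>
    have h0 := update_rename hρ hm b false
    have h1 := update_rename hρ hm b true
    simpa [Instr.step, Instr.rename, Holds, ha] using ⟨h0, h1⟩

theorem sum_map_eq_of_forall₂ {α β : Type*} {R : α → β → Prop} {f : α → ℝ} {g : β → ℝ}
    {L : List α} {L' : List β} (h : List.Forall₂ R L L') (hfg : ∀ a b, R a b → g b = f a) :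
    (L'.map g).sum = (L.map f).sum := by
  induction h with
  | nil => rfl
  | cons h _ ih => simp [ih, hfg _ _ h]

/-- The final part of a simulation: the output bit is moved to the cell `0`. -/
theorem Holds.acceptProb_output {m : ℕ} {ρ : ℕ → ℕ} {c d : Config m} (h : Holds ρ c d) :
    acceptProb (runProg Instr.step
      ([⟨0, ρ 0, ρ 0⟩, ⟨0, 0, 0⟩].map (Instr.classical (m := m))) d) =
        if c.mem 0 then c.weight else 0 := by
  have := runProg_classical_append (m := m) [⟨0, ρ 0, ρ 0⟩, ⟨0, 0, 0⟩] [] d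
  rw [List.append_nil] at this
  rw [this, acceptProb_runProg_nil]
  simp [runGates, NandGate.apply, h.2, Config.weight, h.1]

theorem Holds.acceptProb_rename {m : ℕ} {ρ : ℕ → ℕ} (hρ : ρ.Injective) (p : List (Instr m))
    {c d : Config m} (h : Holds ρ c d) :
    acceptProb (runProg Instr.step (p.map (Instr.rename ρ) ++
      [⟨0, ρ 0, ρ 0⟩, ⟨0, 0, 0⟩].map Instr.classical) d) =
        acceptProb (runProg Instr.step p c) := by
  induction p generalizing c d with
  | nil => rw [List.map_nil, List.nil_append, h.acceptProb_output, acceptProb_runProg_nil]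
  | cons i p ih =>
    rw [List.map_cons, List.cons_append, acceptProb_runProg_cons, acceptProb_runProg_cons]
    exact sum_map_eq_of_forall₂ (h.step hρ i) fun a b hab => ih hab.1

/-- A distinguisher can be applied to the result of a computation on its input. -/
theorem Distinguisher.exists_precomp (D : Distinguisher) {L M k : ℕ} {f : Mem → Fin M → Bool}
    (h : Comp (insert (fun _ => false) (cells (Set.Iio (L + 1)))) k f) :
    ∃ D' : Distinguisher, D'.size ≤ D.size + (k + 4 * M + 5) ∧
      ∀ x : List Bool, x.length ≤ L → D'.accept x = D.accept (List.ofFn (f (Mem.load x))) := by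
  -- Beyond the input, the simulated memory and the scratch cells alternate. The input region has `L
  -- + 1` cells so that it is nonempty even for `L = 0`.
  set ρ : ℕ → ℕ := fun p => L + 1 + 2 * p with hρ
  have hρi : ρ.Injective := fun a b e => by simp only [hρ] at e; omega
  obtain ⟨gs, h1, h2⟩ := h.exists_assign (fr := fun p => L + 2 + 2 * p) (d := fun j => ρ j)
    ⟨0, by simp⟩ (fun a b e => by simp only at e; omega) (fun i => by simp; omega)
    (fun a b e => Fin.ext (hρi e)) (fun i j => by simp only [hρ]; omega)
  refine ⟨⟨D.qubits, gs.map Instr.classical ++ (D.prog.map (Instr.rename ρ) ++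
      [⟨0, ρ 0, ρ 0⟩, ⟨0, 0, 0⟩].map Instr.classical)⟩, ?_, fun x hx => ?_⟩
  · simp only [Distinguisher.size, List.length_append, List.length_map, List.length_cons,
      List.length_nil]
    omega
  · rw [Distinguisher.accept, runProg_classical_append, Distinguisher.accept]
    refine Holds.acceptProb_rename hρi _ ⟨rfl, fun p => ?_⟩
    by_cases hp : p < M
    · simpa [Config.init, Mem.load, List.getD_eq_getElem?_getD, hp] using (h2 _).1 ⟨p, hp⟩
    · have := (h2 (Mem.load x)).2 (ρ p) (fun i => by simp only [hρ]; omega)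
        (fun j e => hp (hρi e ▸ j.2))
      simp only [Config.init]
      rw [this, Mem.load_of_length_le (by simp only [hρ]; omega),
        Mem.load_of_length_le (by simpa using hp)]

/-! ### Tables -/

/-- The bit-string that lists the rows of a table. -/
def flat {q w : ℕ} (T : Fin q → Fin w → Bool) : List Bool :=
  List.ofFn fun i : Fin (q * w) => T i.divNat i.modNat

theorem flat_eq_flatten {q w : ℕ} (T : Fin q → Fin w → Bool) :
    flat T = (List.ofFn fun i => List.ofFn (T i)).flatten := by
  rw [flat, List.ofFn_mul]
  congr 2
  funext i
  congr 1
  funext j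
  congr 1
  · ext
    have := j.2
    simp [Fin.divNat, Nat.mul_comm _ w, Nat.mul_add_div (by omega : 0 < w),
      Nat.div_eq_of_lt this]
  · ext
    simp [Fin.modNat, Nat.mod_eq_of_lt j.2]

theorem add_lt_mul_of_lt {r q w : ℕ} (hr : r < q) (u : Fin w) : r * w + u < q * w := by
  have := u.2
  calc r * w + u < (r + 1) * w := by rw [Nat.succ_mul]; omega
    _ ≤ q * w := Nat.mul_le_mul_right _ hr

theorem load_flat {q w : ℕ} (T : Fin q → Fin w → Bool) {r : ℕ} (hr : r < q) (u : Fin w) :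
    Mem.load (flat T) (r * w + u) = T ⟨r, hr⟩ u := by
  have hu := u.2
  have h := add_lt_mul_of_lt hr u
  simp only [Mem.load, flat, List.getD_eq_getElem?_getD, List.getElem?_ofFn, h, dif_pos,
    Option.getD_some]
  congr 1
  · simp [Fin.divNat, Nat.mul_comm _ w, Nat.mul_add_div (by omega : 0 < w),
      Nat.div_eq_of_lt hu]
  · ext
    simp [Fin.modNat, Nat.mod_eq_of_lt hu]

/-- A distinguisher can be applied to a table whose rows are computed from its input table. -/
theorem Distinguisher.exists_precomp_table (D : Distinguisher) {q w q' w' k : ℕ}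
    {τ : (Fin q → Fin w → Bool) → Fin q' → Fin w' → Bool}
    (h : ∀ (B : Set (Mem → Bool)) (t : Mem → Fin q → Fin w → Bool), (fun _ => false) ∈ B →
      (∀ r, BitsIn B fun c => t c r) → ∀ i, Comp B k fun c => τ (t c) i) :
    ∃ D' : Distinguisher, D'.size ≤ D.size + (q' * k + 4 * (q' * w') + 5) ∧
      ∀ T, D'.accept (flat T) = D.accept (flat (τ T)) := by
  have h1 := h (insert (fun _ => false) (cells (Set.Iio (q * w + 1)))) (fun c r u => c (r * w + u))
    (by simp) (fun r u => Or.inr ⟨r * w + u, ?_, rfl⟩)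
  · have h2 := (Comp.pi h1).reindex fun i : Fin (q' * w') => (i.divNat, i.modNat)
    rw [Fintype.card_fin] at h2
    obtain ⟨D', hD, hD'⟩ := D.exists_precomp h2
    refine ⟨D', hD, fun T => ?_⟩
    have e : (fun (r : Fin q) (u : Fin w) => Mem.load (flat T) (r * w + u)) = T := by
      funext r u
      exact load_flat T r.2 u
    rw [hD' _ (by simp [flat]), e, flat]
  · have := add_lt_mul_of_lt r.2 u
    simp only [Set.mem_Iio]
    omega

/-! ### Oracles answered from a table -/

/-- The string `x` with the bits from position `j` on set to `false`. -/
def mask {a : ℕ} (j : ℕ) (x : Fin a → Bool) : Fin a → Bool := fun i => decide (i.val < j) && x i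

/-- The acceptance probability of a program whose oracle queries are answered by means of a table:
the answer to `x` is `Φ x t`, where `t` is the row whose number is the number of the first query
with the same masked string as `x`. Here `K` is the list of the masked strings of the earlier
queries. -/
noncomputable def lazyAccept {m a b w : ℕ} (j : ℕ)
    (Φ : (Fin a → Bool) → (Fin w → Bool) → (Fin b → Bool)) (T : List (Fin w → Bool)) :
    List (OracleInstr m a) → List (Fin a → Bool) → Config m → ℝ
  | [], _, c => if c.mem 0 then c.weight else 0
  | .plain i :: p, K, c => ((i.step c).map (lazyAccept j Φ T p K)).sum
  | .query ins out :: p, K, c =>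
      lazyAccept j Φ T p (K ++ [mask j fun k => c.mem (ins k)])
        ⟨c.mem.write out (Φ (fun k => c.mem (ins k))
          (T.getD (K.idxOf (mask j fun k => c.mem (ins k))) fun _ => false)), c.amp⟩

section Simulation

variable {a b w : ℕ}

/-- `Φ` is computed by at most `k` gates. -/
def BinaryComp (k : ℕ) (Φ : (Fin a → Bool) → (Fin w → Bool) → (Fin b → Bool)) : Prop :=
  ∀ (B : Set (Mem → Bool)) (x : Mem → Fin a → Bool) (t : Mem → Fin w → Bool),
    (fun _ => false) ∈ B → BitsIn B x → BitsIn B t → Comp B k fun c => Φ (x c) (t c)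

theorem BitsIn.mask {X : Type*} {B : Set (X → Bool)} (hB : (fun _ => false) ∈ B) {j : ℕ}
    {x : X → Fin a → Bool} (hx : BitsIn B x) : BitsIn B fun c => mask j (x c) := by
  intro i
  by_cases h : i.val < j
  · simpa [NRPRF.mask, h] using hx i
  · simpa [NRPRF.mask, h] using hB

/-- The number of gates for the simulation of one instruction. -/
def simCost (Q a b w k : ℕ) : ℕ := Q * (a * 7 + 1 + w * 4) + k + 6 + 4 * a + 4 * b + 1

/-- The memory of the simulation: the table, the cells of the simulated program, and the masked
strings of the earlier queries. -/
def SimHolds {m : ℕ} (L Q : ℕ) (T : List (Fin w → Bool)) (K : List (Fin a → Bool))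
    (c d : Config m) : Prop :=
  Holds (fun p => L + 1 + 3 * p) c d ∧
    (∀ r < Q, ∀ u : Fin w, d.mem (r * w + u) = T.getD r (fun _ => false) u) ∧
    ∀ (r : ℕ) (hr : r < K.length) (u : Fin a), d.mem (L + 2 + 3 * (r * a + u)) = K[r] u

/-- The masked query is compared with the `i` saved ones. If it is new, the search returns `i`,
which is the number of an unused row, so no case distinction is needed. -/
theorem exists_query_gates {m k Q i : ℕ} {Φ : (Fin a → Bool) → (Fin w → Bool) → (Fin b → Bool)}
    (hΦ : BinaryComp k Φ) (j : ℕ) (hi : i < Q) (ins : Fin a → ℕ) (out : ℕ) :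
    ∃ gs : List NandGate, gs.length ≤ simCost Q a b w k ∧
      ∀ (T : List (Fin w → Bool)) (K : List (Fin a → Bool)) (c d : Config m), K.length = i →
        SimHolds (Q * w) Q T K c d →
        SimHolds (Q * w) Q T (K ++ [mask j fun k => c.mem (ins k)])
          ⟨c.mem.write out (Φ (fun k => c.mem (ins k))
            (T.getD (K.idxOf (mask j fun k => c.mem (ins k))) fun _ => false)), c.amp⟩
          ⟨runGates gs d.mem, d.amp⟩ := by
  -- Above the table the memory is divided into three residue classes modulo 3: simulated cells `ρ`,
  -- saved queries `sv` and scratch cells `fr`.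
  set L := Q * w with hL
  set ρ : ℕ → ℕ := fun p => L + 1 + 3 * p with hρ
  set sv : ℕ → ℕ := fun p => L + 2 + 3 * p with hsv
  set fr : ℕ → ℕ := fun p => L + 3 + 3 * p with hfr
  have hfri : fr.Injective := fun x y e => by simp only [hfr] at e; omega
  set P : Set ℕ := (Set.range fr)ᶜ with hP
  have hPne : P.Nonempty := ⟨0, by simp [hP, hfr]⟩
  have hPfr : ∀ i, fr i ∉ P := by simp [hP]
  set B := insert (fun _ => false) (cells P) with hB
  have hB0 : (fun _ => false) ∈ B := by simp [hB]
  have hcell : ∀ p, (∀ i, p ≠ fr i) → (fun c : Mem => c p) ∈ B := fun p hp =>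
    Or.inr ⟨p, by rintro ⟨i, rfl⟩; exact hp i rfl, rfl⟩
  have hx : BitsIn B fun (c : Mem) k => c (ρ (ins k)) := fun u =>
    hcell _ fun i => by simp only [hρ, hfr]; omega
  set keys : List (Mem → Fin a → Bool) :=
    List.ofFn fun (r : Fin i) (c : Mem) u => c (sv (r * a + u)) with hkeys
  set tab : ℕ → Mem → Fin w → Bool := fun r c u => c (r * w + u) with htab
  have hlook := Comp.lookup hB0 (hx.mask hB0 (j := j)) keys
    (by
      intro f hf u
      obtain ⟨r, rfl⟩ := List.mem_ofFn.1 hf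
      exact hcell _ fun i => by simp only [hsv, hfr]; omega)
    tab
    (by
      intro r hr u
      have := add_lt_mul_of_lt (lt_of_le_of_lt hr (by simpa [hkeys] using hi)) u
      exact hcell _ fun i => by simp only [hfr]; omega)
  have hans := hlook.bind fun B' hB' ht => hΦ B' _ _ (hB' hB0) (hx.mono hB') ht
  -- The masked query is saved before the answer is written, since the answer may overwrite the
  -- cells `ins`.
  obtain ⟨g1, hg1, hg1'⟩ := (Comp.of_mem (hx.mask hB0 (j := j))).exists_assign hPne hfri hPfr
    (d := fun u : Fin a => sv (i * a + u)) (fun u v e => by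
      simp only [hsv] at e; exact Fin.ext (by omega)) (fun i j => by simp only [hsv, hfr]; omega)
  obtain ⟨g2, hg2, hg2'⟩ := hans.exists_assign hPne hfri hPfr
    (d := fun u : Fin b => ρ (out + u)) (fun u v e => by
      simp only [hρ] at e; exact Fin.ext (by omega)) (fun i j => by simp only [hρ, hfr]; omega)
  refine ⟨g1 ++ g2, ?_, ?_⟩
  · have : keys.length * (a * 7 + 1 + w * 4) ≤ Q * (a * 7 + 1 + w * 4) :=
      Nat.mul_le_mul_right _ (by simpa [hkeys] using hi.le)
    simp only [List.length_append, simCost]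
    omega
  intro T K c d hK ⟨⟨hamp, hmem⟩, hT, hkey⟩
  obtain ⟨hs1, ho1⟩ := hg1' d.mem
  obtain ⟨hs2, ho2⟩ := hg2' (runGates g1 d.mem)
  have hρ1 : ∀ p, runGates g1 d.mem (ρ p) = c.mem p := fun p => by
    rw [ho1 _ (fun i => by simp only [hρ, hfr]; omega) (fun u => by simp only [hρ, hsv]; omega)]
    exact hmem p
  have hT1 : ∀ r < Q, ∀ u : Fin w,
      runGates g1 d.mem (r * w + u) = T.getD r (fun _ => false) u := fun r hr u => by
    have := add_lt_mul_of_lt hr u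
    rw [ho1 _ (fun i => by simp only [hfr]; omega) (fun u => by simp only [hsv]; omega)]
    exact hT r hr u
  have hkey1 : ∀ (r : ℕ) (hr : r < K.length) (u : Fin a),
      runGates g1 d.mem (sv (r * a + u)) = K[r] u := fun r hr u => by
    have := add_lt_mul_of_lt (hK ▸ hr) u
    rw [ho1 _ (fun i => by simp only [hsv, hfr]; omega) (fun u => by simp only [hsv]; omega)]
    exact hkey r hr u
  have hx1 : (fun k => runGates g1 d.mem (ρ (ins k))) = fun k => c.mem (ins k) :=
    funext fun k => hρ1 _
  have hK1 : (keys.map fun f => f (runGates g1 d.mem)) = K := by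
    refine List.ext_getElem (by simp [hkeys, hK]) fun r h1 h2 => ?_
    funext u
    rw [List.getElem_map, List.getElem_of_eq hkeys, List.getElem_ofFn]
    exact hkey1 r h2 u
  refine ⟨⟨hamp, fun p => ?_⟩, fun r hr u => ?_, fun r hr u => ?_⟩
  · simp only [runGates_append]
    by_cases hp : out ≤ p ∧ p < out + b
    · have h3 := hs2 ⟨p - out, by omega⟩
      rw [show out + (p - out) = p by omega, hx1, hK1] at h3
      simp only [Mem.write, dif_pos hp]
      rw [h3]
      congr 2
      funext u
      exact hT1 _ (lt_of_le_of_lt List.idxOf_le_length (hK ▸ hi)) u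
    · simp only [Mem.write, dif_neg hp]
      rw [ho2 _ (fun i => by simp only [hfr]; omega) (fun u => by simp only [hρ]; omega)]
      exact hρ1 p
  · simp only [runGates_append]
    have := add_lt_mul_of_lt hr u
    rw [ho2 _ (fun i => by simp only [hfr]; omega) (fun u => by simp only [hρ]; omega)]
    exact hT1 r hr u
  · simp only [runGates_append]
    rw [ho2 _ (fun i => by simp only [hfr]; omega) (fun u => by simp only [hρ]; omega)]
    rw [List.length_append, List.length_singleton] at hr
    by_cases hr' : r < K.length
    · rw [List.getElem_append_left hr']
      exact hkey1 r hr' u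
    · obtain rfl : r = K.length := by omega
      have h3 := hs1 u
      rw [← hK] at h3
      simp only [hsv] at h3
      rw [h3]
      have : (fun k => d.mem (ρ (ins k))) = fun k => c.mem (ins k) := funext fun k => hmem _
      simp [this]

/-- Programs have no jumps, so the number `i` of earlier queries is the same in all branches and the
cells for the saved strings can be fixed in advance. -/
theorem exists_sim_prog {m k Q : ℕ} {Φ : (Fin a → Bool) → (Fin w → Bool) → (Fin b → Bool)}
    (hΦ : BinaryComp k Φ) (j : ℕ) (p : List (OracleInstr m a)) (i : ℕ) (hi : i + p.length ≤ Q) :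
    ∃ prog : List (Instr m), prog.length ≤ p.length * simCost Q a b w k + 2 ∧
      ∀ (T : List (Fin w → Bool)) (K : List (Fin a → Bool)) (c d : Config m), K.length = i →
        SimHolds (Q * w) Q T K c d →
        acceptProb (runProg Instr.step prog d) = lazyAccept j Φ T p K c := by
  induction p generalizing i with
  | nil =>
    refine ⟨[⟨0, Q * w + 1 + 3 * 0, Q * w + 1 + 3 * 0⟩, ⟨0, 0, 0⟩].map Instr.classical,
      by simp, fun T K c d _ h => ?_⟩
    rw [lazyAccept]
    exact h.1.acceptProb_output
  | cons o p ih =>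
    rw [List.length_cons] at hi
    cases o with
    | plain o =>
      obtain ⟨prog, h1, h2⟩ := ih i (by omega)
      refine ⟨o.rename (fun p => Q * w + 1 + 3 * p) :: prog, ?_, fun T K c d hK h => ?_⟩
      · have : 1 ≤ simCost Q a b w k := by simp [simCost]
        rw [List.length_cons, List.length_cons, Nat.succ_mul]
        omega
      · rw [acceptProb_runProg_cons, lazyAccept]
        refine sum_map_eq_of_forall₂ (h.1.step (fun x y e => by simpa using e) o)
          fun c' d' hcd => h2 T K c' d' hK ⟨hcd.1, fun r hr u => ?_, fun r hr u => ?_⟩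
        · have := add_lt_mul_of_lt hr u
          rw [hcd.2 _ fun i => by omega]
          exact h.2.1 r hr u
        · rw [hcd.2 _ fun i => by omega]
          exact h.2.2 r hr u
    | query ins out =>
      obtain ⟨prog, h1, h2⟩ := ih (i + 1) (by omega)
      obtain ⟨gs, h3, h4⟩ := exists_query_gates (m := m) hΦ j (by omega : i < Q) ins out
      refine ⟨gs.map Instr.classical ++ prog, ?_, fun T K c d hK h => ?_⟩
      · rw [List.length_append, List.length_map, List.length_cons, Nat.succ_mul]
        omega
      · rw [runProg_classical_append, lazyAccept]
        exact h2 T _ _ _ (by simp [hK]) (h4 T K c d hK h)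

/-- An oracle program can be simulated by a program that finds the table in its input. -/
theorem OracleDistinguisher.exists_sim {k Q : ℕ}
    {Φ : (Fin a → Bool) → (Fin w → Bool) → (Fin b → Bool)} (hΦ : BinaryComp k Φ) (j : ℕ)
    (A : OracleDistinguisher a) (hQ : A.size ≤ Q) :
    ∃ D : Distinguisher, D.size ≤ Q + (Q * simCost Q a b w k + 2) ∧
      ∀ T : Fin Q → Fin w → Bool, D.accept (flat T) =
        lazyAccept j Φ (List.ofFn T) A.prog [] (Config.init A.qubits (Mem.load [])) := by
  have hA : A.prog.length ≤ Q := le_trans (Nat.le_add_left _ _) hQ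
  obtain ⟨prog, h1, h2⟩ := exists_sim_prog (Q := Q) hΦ j A.prog 0 (by omega)
  refine ⟨⟨A.qubits, prog⟩, ?_, fun T => ?_⟩
  · have h3 := Nat.mul_le_mul_right (simCost Q a b w k) hA
    have h4 : A.qubits ≤ Q := le_trans (Nat.le_add_right _ _) hQ
    simp only [Distinguisher.size]
    omega
  · refine h2 _ _ _ _ rfl ⟨⟨rfl, fun p => ?_⟩, fun r hr u => ?_, by simp⟩
    · simp only [Config.init]
      rw [Mem.load_of_length_le (by simp [flat]; omega), Mem.load_of_length_le (by simp)]
    · simp only [Config.init]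
      rw [load_flat T hr u]
      simp [List.getD_eq_getElem?_getD, hr]

end Simulation

/-! ### Expectations -/

section Expect

variable {α β ι κ V : Type*} [Fintype α] [Fintype β] [Fintype ι] [DecidableEq ι] [Fintype κ]
  [DecidableEq κ] [Fintype V]

theorem expect_prod (f : α × β → ℝ) : 𝔼 ω, f ω = 𝔼 a, 𝔼 b, f (a, b) :=
  Finset.expect_product _ _ f

theorem abs_expect_sub_le [Nonempty α] {f g : α → ℝ} {ε : ℝ} (h : ∀ a, |f a - g a| ≤ ε) :
    |(𝔼 a, f a) - 𝔼 a, g a| ≤ ε := by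
  rw [← Finset.expect_sub_distrib]
  refine (Finset.abs_expect_le _ _).trans ((Finset.expect_le_expect fun a _ => h a).trans ?_)
  rw [Fintype.expect_const]

/-- Resampling one value of a uniformly random function leaves its distribution unchanged. -/
theorem expect_eq_expect_update [Nonempty V] (i : ι) (F : (ι → V) → ℝ) :
    𝔼 R, F R = 𝔼 v, 𝔼 R, F (Function.update R i v) := by
  let e := Equiv.funSplitAt i V
  have he : ∀ R v, Function.update R i v = e.symm (v, (e R).2) := by
    intro R v
    funext j
    by_cases hj : j = i
    · subst hj; simp [e]
    · simp [e, hj]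
  have h1 : ∀ H : (ι → V) → ℝ, 𝔼 R, H R = 𝔼 v, 𝔼 r, H (e.symm (v, r)) := fun H => by
    rw [← expect_prod fun p => H (e.symm p)]
    exact Fintype.expect_equiv e _ _ (by simp)
  rw [h1]
  refine Finset.expect_congr rfl fun v _ => ?_
  rw [h1]
  simp [he]

theorem expect_comp_injective [Nonempty V] {f : ι → κ} (hf : f.Injective) (F : (ι → V) → ℝ) :
    𝔼 R : κ → V, F (R ∘ f) = 𝔼 R, F R := by
  classical
  let e : (κ → V) ≃ (ι → V) × ({x // x ∉ Set.range f} → V) :=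
    (Equiv.piEquivPiSubtypeProd (· ∈ Set.range f) fun _ => V).trans
      (((Equiv.ofInjective f hf).symm.arrowCongr (Equiv.refl V)).prodCongr (Equiv.refl _))
  have he : ∀ R, (e R).1 = R ∘ f := fun R => by
    funext i
    simp [e, Equiv.piEquivPiSubtypeProd, Equiv.arrowCongr]
  rw [Fintype.expect_equiv e (fun R => F (R ∘ f)) (fun p => F p.1) fun R => by rw [he],
    expect_prod]
  simp

theorem expect_cons {n : ℕ} (F : (Fin (n + 1) → V) → ℝ) :
    𝔼 v, F v = 𝔼 x, 𝔼 v : Fin n → V, F (Fin.cons x v) := by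
  rw [← expect_prod fun p : V × (Fin n → V) => F (Fin.cons p.1 p.2)]
  exact (Fintype.expect_equiv (Fin.consEquiv fun _ => V) _ _ fun _ => rfl).symm

/-- The hybrid argument: samples of the form `α c (a i)` with common `c` are replaced by samples of
the form `β (b i)` one by one. -/
theorem abs_expect_hybrid {C A B W : Type*} [Fintype C] [Fintype A] [Fintype B] [Nonempty A]
    [Nonempty B] [Nonempty C] {q : ℕ} (α : C → A → W) (β : B → W) (F : (Fin q → W) → ℝ) {ε : ℝ}
    (h : ∀ (t : Fin q) (a : Fin q → A) (b : Fin q → B),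
      |(𝔼 c, 𝔼 x, F fun i => if i < t then β (b i) else if i = t then α c x else α c (a i)) -
        𝔼 c, 𝔼 y, F fun i => if i < t then β (b i) else if i = t then β y else α c (a i)| ≤ ε) :
    |(𝔼 c, 𝔼 a : Fin q → A, F fun i => α c (a i)) - 𝔼 b : Fin q → B, F fun i => β (b i)| ≤
      q * ε := by
  let H : ℕ → ℝ := fun t => 𝔼 a : Fin q → A, 𝔼 b : Fin q → B, 𝔼 c,
    F fun i => if i.val < t then β (b i) else α c (a i)
  have h0 : H 0 = 𝔼 c, 𝔼 a : Fin q → A, F fun i => α c (a i) := by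
    simp only [H, Nat.not_lt_zero, if_false, Fintype.expect_const]
    rw [Finset.expect_comm]
  have hq : H q = 𝔼 b : Fin q → B, F fun i => β (b i) := by
    simp only [H, Fin.is_lt, if_true, Fintype.expect_const]
  have hstep : ∀ t < q, |H t - H (t + 1)| ≤ ε := by
    intro t ht
    have e1 : H t = 𝔼 a : Fin q → A, 𝔼 b : Fin q → B, 𝔼 c, 𝔼 x,
        F fun i => if i < ⟨t, ht⟩ then β (b i) else if i = ⟨t, ht⟩ then α c x else α c (a i) := by
      -- The sample at `t` is resampled in `a` here and in `b` below. The entries of `a` and `b`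
      -- that a hybrid does not use average out.
      simp only [H]
      rw [expect_eq_expect_update ⟨t, ht⟩, Finset.expect_comm]
      refine Finset.expect_congr rfl fun a _ => ?_
      rw [Finset.expect_comm]
      refine Finset.expect_congr rfl fun b _ => ?_
      rw [Finset.expect_comm]
      refine Finset.expect_congr rfl fun c _ => Finset.expect_congr rfl fun x _ => ?_
      congr 1
      funext i
      simp only [Fin.lt_def, Function.update_apply]
      split_ifs <;> rfl
    have e2 : H (t + 1) = 𝔼 a : Fin q → A, 𝔼 b : Fin q → B, 𝔼 c, 𝔼 y,
        F fun i => if i < ⟨t, ht⟩ then β (b i) else if i = ⟨t, ht⟩ then β y else α c (a i) := by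
      simp only [H]
      refine Finset.expect_congr rfl fun a _ => ?_
      rw [expect_eq_expect_update ⟨t, ht⟩, Finset.expect_comm]
      refine Finset.expect_congr rfl fun b _ => ?_
      rw [Finset.expect_comm]
      refine Finset.expect_congr rfl fun c _ => Finset.expect_congr rfl fun x _ => ?_
      congr 1
      funext i
      simp only [Fin.lt_def, Function.update_apply, Fin.ext_iff]
      split_ifs <;> first | rfl | omega
    rw [e1, e2]
    exact abs_expect_sub_le fun a => abs_expect_sub_le fun b => h _ a b
  rw [← h0, ← hq, ← Finset.sum_range_sub' H q]
  refine (Finset.abs_sum_le_sum_abs _ _).trans ((Finset.sum_le_sum fun t ht =>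
    hstep t (Finset.mem_range.1 ht)).trans ?_)
  simp

end Expect

/-! ### Lazy sampling -/

section LazySampling

/-- If `y` is already a key, then neither the appended row nor the value of `R` at `y` is ever read;
otherwise both supply `v` at `y`. Repeated and new queries are therefore treated alike. -/
theorem getD_idxOf_append {ι V : Type*} [DecidableEq ι] {K : List ι} {u : List V}
    (h : K.length = u.length) (y z : ι) (v : V) (R : ι → V) :
    (u ++ [v]).getD ((K ++ [y]).idxOf z) (R z) =
      u.getD (K.idxOf z) (Function.update R y v z) := by
  rw [List.idxOf_append]
  by_cases hz : z ∈ K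
  · have h1 := List.idxOf_lt_length_iff.2 hz
    have h2 : K.idxOf z < u.length := h ▸ h1
    simp [hz, List.getD_eq_getElem?_getD, h2, List.getElem?_append_left h2]
  · rw [if_neg hz, List.idxOf_eq_length hz]
    by_cases hzy : z = y
    · subst hzy
      simp [h, List.getD_eq_getElem?_getD]
    · simp [h, List.getD_eq_getElem?_getD, hzy]

theorem expect_list_sum {α β : Type*} [Fintype α] (L : List β) (f : α → β → ℝ) :
    𝔼 x, (L.map (f x)).sum = (L.map fun y => 𝔼 x, f x y).sum := by
  induction L with
  | nil => simp
  | cons y L ih => simp [Finset.expect_add_distrib, ih]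

variable {a b w : ℕ} {V : Type*} [Fintype V] [Nonempty V]

/-- The rows `u` have been assigned to the keys `K`, and `R` answers all other keys. Every query
consumes a row, so `r` rows suffice for at most `r` remaining instructions. -/
theorem expect_lazyAccept_aux {m : ℕ} (j : ℕ)
    (Φ : (Fin a → Bool) → (Fin w → Bool) → (Fin b → Bool)) (e : V → Fin w → Bool)
    (p : List (OracleInstr m a)) (r : ℕ) (hr : p.length ≤ r) (K : List (Fin a → Bool))
    (u : List V) (hK : K.length = u.length) (c : Config m) :
    𝔼 v : Fin r → V, lazyAccept j Φ ((u ++ List.ofFn v).map e) p K c =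
      𝔼 R : (Fin a → Bool) → V, acceptProb (runProg (OracleInstr.step fun x =>
        Φ x (e (u.getD (K.idxOf (mask j x)) (R (mask j x))))) p c) := by
  induction p generalizing r K u c with
  | nil => simp [lazyAccept, acceptProb_runProg_nil]
  | cons o p ih =>
    rw [List.length_cons] at hr
    cases o with
    | plain o =>
      simp only [lazyAccept, acceptProb_runProg_cons, OracleInstr.step]
      rw [expect_list_sum, expect_list_sum]
      congr 2
      funext c'
      exact ih r (by omega) K u hK c'
    | query ins out =>
      obtain ⟨r, rfl⟩ : ∃ r', r = r' + 1 := ⟨r - 1, by omega⟩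
      set y := mask j fun k => c.mem (ins k) with hy
      -- The next row of the table is coupled with a fresh value of `R` at `y`.
      rw [expect_cons, expect_eq_expect_update y]
      refine Finset.expect_congr rfl fun v _ => ?_
      have key := ih r (by omega) (K ++ [y]) (u ++ [v]) (by simp [hK])
        ⟨c.mem.write out (Φ (fun k => c.mem (ins k)) (e (u.getD (K.idxOf y) v))), c.amp⟩
      simp only [getD_idxOf_append hK] at key
      refine Eq.trans (Finset.expect_congr rfl fun v' _ => ?_)
        (key.trans (Finset.expect_congr rfl fun R _ => ?_))
      · rw [lazyAccept, ← hy]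
        have h1 : u ++ List.ofFn (Fin.cons v v' : Fin (r + 1) → V) =
            u ++ [v] ++ List.ofFn v' := by simp
        have h2 : ((u ++ [v] ++ List.ofFn v').map e).getD (K.idxOf y) (fun _ => false) =
            e (u.getD (K.idxOf y) v) := by
          have hle : K.idxOf y ≤ u.length := hK ▸ List.idxOf_le_length
          rcases hle.lt_or_eq with h | h
          · have h' : K.idxOf y < (u.map e).length := by simpa using h
            simp [List.getD_eq_getElem?_getD, List.getElem?_append_left h', h]
          · simp [List.getD_eq_getElem?_getD, h]
        rw [h1, h2]
      · rw [acceptProb_runProg_cons]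
        simp [OracleInstr.step, ← hy]

/-- Sampling the rows of the table amounts to sampling a random function. -/
theorem expect_lazyAccept (j : ℕ) (Φ : (Fin a → Bool) → (Fin w → Bool) → (Fin b → Bool))
    (e : V → Fin w → Bool) (A : OracleDistinguisher a) {Q : ℕ} (hQ : A.size ≤ Q) :
    𝔼 v : Fin Q → V, lazyAccept j Φ (List.ofFn fun i => e (v i)) A.prog []
        (Config.init A.qubits (Mem.load [])) =
      𝔼 R : (Fin a → Bool) → V, A.accept fun x => Φ x (e (R (mask j x))) := by
  have h := expect_lazyAccept_aux j Φ e A.prog Q (le_trans (Nat.le_add_left _ _) hQ) [] [] rfl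
    (Config.init A.qubits (Mem.load []))
  simpa [List.map_ofFn, Function.comp_def, OracleDistinguisher.accept] using h

end LazySampling

/-! ### Polynomial bounds and negligible functions -/

theorem PolyBounded.of_le {f g : ℕ → ℕ} (hg : PolyBounded g) (h : ∀ n, f n ≤ g n) :
    PolyBounded f := by
  obtain ⟨p, hp⟩ := hg
  exact ⟨p, fun n => (h n).trans (hp n)⟩

theorem PolyBounded.const (k : ℕ) : PolyBounded fun _ => k := ⟨Polynomial.C k, fun n => by simp⟩

theorem PolyBounded.eval (p : Polynomial ℕ) : PolyBounded fun n => p.eval n := ⟨p, fun _ => le_rfl⟩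

theorem PolyBounded.add {f g : ℕ → ℕ} (hf : PolyBounded f) (hg : PolyBounded g) :
    PolyBounded fun n => f n + g n := by
  obtain ⟨p, hp⟩ := hf
  obtain ⟨q, hq⟩ := hg
  exact ⟨p + q, fun n => by simpa using add_le_add (hp n) (hq n)⟩

theorem PolyBounded.mul {f g : ℕ → ℕ} (hf : PolyBounded f) (hg : PolyBounded g) :
    PolyBounded fun n => f n * g n := by
  obtain ⟨p, hp⟩ := hf
  obtain ⟨q, hq⟩ := hg
  exact ⟨p * q, fun n => by simpa using Nat.mul_le_mul (hp n) (hq n)⟩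

theorem Negligible.of_le {f g : ℕ → ℝ} (hg : Negligible g) (h0 : ∀ n, 0 ≤ f n)
    (h : ∀ n, f n ≤ g n) : Negligible f :=
  Asymptotics.SuperpolynomialDecay.trans_abs_le hg fun n => by
    rw [abs_of_nonneg (h0 n)]
    exact (h n).trans (le_abs_self _)

theorem Negligible.add {f g : ℕ → ℝ} (hf : Negligible f) (hg : Negligible g) :
    Negligible fun n => f n + g n :=
  Asymptotics.SuperpolynomialDecay.add hf hg

theorem Negligible.polyBounded_mul {f : ℕ → ℝ} (hf : Negligible f) (h0 : ∀ n, 0 ≤ f n)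
    {q : ℕ → ℕ} (hq : PolyBounded q) : Negligible fun n => q n * f n := by
  obtain ⟨p, hp⟩ := hq
  have h := Asymptotics.SuperpolynomialDecay.polynomial_mul hf (p.map (Nat.castRingHom ℝ))
  refine Negligible.of_le h (fun n => mul_nonneg (Nat.cast_nonneg _) (h0 n)) fun n => ?_
  refine mul_le_mul_of_nonneg_right ?_ (h0 n)
  rw [Polynomial.eval_natCast_map]
  exact Nat.cast_le.2 (hp n)

/-- Indistinguishability holds uniformly for finite families of distinguishers of polynomially
bounded size. -/
theorem CompIndist.uniform {Ω Ω' ι : ℕ → Type*} [∀ n, Fintype (Ω n)] [∀ n, Fintype (Ω' n)]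
    [∀ n, Finite (ι n)] {X : ∀ n, Ω n → List Bool} {Y : ∀ n, Ω' n → List Bool}
    (h : CompIndist X Y) (D : ∀ n, ι n → Distinguisher) {p : ℕ → ℕ} (hp : PolyBounded p)
    (hD : ∀ n i, (D n i).size ≤ p n) :
    ∃ ε : ℕ → ℝ, Negligible ε ∧ (∀ n, 0 ≤ ε n) ∧
      ∀ n i, |(𝔼 ω, (D n i).accept (X n ω)) - 𝔼 ω, (D n i).accept (Y n ω)| ≤ ε n := by
  have H : ∀ n, ∃ A : Distinguisher, A.size ≤ p n ∧ ∀ i,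
      |(𝔼 ω, (D n i).accept (X n ω)) - 𝔼 ω, (D n i).accept (Y n ω)| ≤
        |(𝔼 ω, A.accept (X n ω)) - 𝔼 ω, A.accept (Y n ω)| := by
    intro n
    cases isEmpty_or_nonempty (ι n) with
    | inl _ => exact ⟨⟨0, []⟩, by simp [Distinguisher.size], fun i => isEmptyElim i⟩
    | inr _ =>
      -- The non-uniform adversary uses the index with the largest advantage, so its advantage
      -- serves as `ε`.
      obtain ⟨i, hi⟩ := Finite.exists_max fun i =>
        |(𝔼 ω, (D n i).accept (X n ω)) - 𝔼 ω, (D n i).accept (Y n ω)|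
      exact ⟨D n i, hD n i, hi⟩
  choose A hA hA' using H
  exact ⟨_, h A (hp.of_le hA), fun n => abs_nonneg _, hA'⟩

namespace EGA

variable {G S : ℕ → Type*} [∀ n, Group (G n)] [∀ n, MulAction (G n) (S n)]
  [∀ n, Fintype (G n)] (E : EGA G S)

/-! ### Encodings and the action on encodings -/

theorem enc_pair {n : ℕ} (s t : S n) : E.enc n [s, t] = flat ![E.canon n s, E.canon n t] := by
  rw [flat_eq_flatten]
  simp [enc]

theorem enc_four {n : ℕ} (s t u v : S n) : E.enc n [s, t, u, v] =
    flat ![E.canon n s, E.canon n t, E.canon n u, E.canon n v] := by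
  rw [flat_eq_flatten]
  simp [enc]

/-- The row of a table that holds two set elements. -/
def pairRow (n : ℕ) (s t : S n) : Fin (E.sLen n + E.sLen n) → Bool :=
  Fin.append (E.canon n s) (E.canon n t)

theorem enc_pairs {n q : ℕ} (s t : Fin q → S n) :
    E.enc n (List.ofFn fun i => [s i, t i]).flatten = flat fun i => E.pairRow n (s i) (t i) := by
  have h : ∀ L : List (List (S n)), E.enc n L.flatten = (L.map (E.enc n)).flatten := by
    intro L
    induction L with
    | nil => rfl
    | cons a L ih =>
      rw [List.flatten_cons, List.map_cons, List.flatten_cons, ← ih]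
      simp [enc]
  rw [h, flat_eq_flatten, List.map_ofFn]
  congr 2
  funext i
  simp [enc, pairRow, List.ofFn_fin_append]

/-- The action of a fixed group element on canonical representations is computed by circuits of
polynomial size, uniformly in the group element. -/
theorem exists_actBits : ∃ (c : ℕ → ℕ) (T : ∀ n, G n → (Fin (E.sLen n) → Bool) →
      (Fin (E.sLen n) → Bool)), PolyBounded c ∧
    (∀ n g s, T n g (E.canon n s) = E.canon n (g • s)) ∧
    ∀ n g (B : Set (Mem → Bool)) (f : Mem → Fin (E.sLen n) → Bool), (fun _ => false) ∈ B →
      BitsIn B f → Comp B (c n) fun x => T n g (f x) := by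
  obtain ⟨Ca, hCa, ha⟩ := E.act
  obtain ⟨Cc, hCc, hc⟩ := E.canonS
  choose rep hrep using E.decG_surj
  -- A string representing `g` is hardwired, which costs one gate; the result of the action is then
  -- brought into canonical form.
  refine ⟨fun n => 1 + ((Ca n).gates.length + (Cc n).gates.length), fun n g y =>
    (Cc n).eval (List.ofFn ((Ca n).eval (List.ofFn (rep n g) ++ List.ofFn y))), ?_, ?_, ?_⟩
  · exact (PolyBounded.const 1).add ((hCa.of_le fun n => Nat.le_add_right _ _).add
      (hCc.of_le fun n => Nat.le_add_right _ _))
  · intro n g s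
    exact hc _ _ _ (ha _ _ _ _ _ (hrep n g) (E.decS_canon n s))
  · intro n g B f hB hf
    refine (Comp.const hB (rep n g)).bind fun B' hB' hr => ?_
    simp only [← List.ofFn_fin_append]
    refine (Comp.circuit (Ca n) ((hr.append (hf.mono hB')).load_ofFn (hB' hB))).bind
      fun B'' hB'' hy => ?_
    exact Comp.circuit (Cc n) (hy.load_ofFn (hB'' (hB' hB)))

/-! ### Relations between the assumptions -/

variable {E}

/-- The DDH challenge is placed at one position; earlier samples are random. Later samples must be
real with the unknown secret `g₀`, and commutativity allows this: `(g₀ * a) • s₀ = a • (g₀ • s₀)` is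
computed from `g₀ • s₀` and the known `a`. -/
theorem NR.of_DDH (hcomm : ∀ n (g h : G n), g * h = h * g) (h : E.DDH) : E.NR := by
  intro Q D hD
  obtain ⟨c, T, hc, hT, hTc⟩ := E.exists_actBits
  have H : ∀ n (i : Fin (Q.eval n) × (Fin (Q.eval n) → G n) × (Fin (Q.eval n) → G n × G n)),
      ∃ D' : Distinguisher, D'.size ≤ (D n).size + (Q.eval n * (1 + c n) +
        4 * (Q.eval n * (E.sLen n + E.sLen n)) + 5) ∧
      ∀ (g₀ : G n) (s t : S n), D'.accept (E.enc n [E.origin n, g₀ • E.origin n, s, t]) =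
        (D n).accept (flat fun k =>
        if k < i.1 then E.pairRow n ((i.2.2 k).1 • E.origin n) ((i.2.2 k).2 • E.origin n) else
        if k = i.1 then E.pairRow n s t else
          E.pairRow n (i.2.1 k • E.origin n) ((g₀ * i.2.1 k) • E.origin n)) := by
    rintro n ⟨t, a, b⟩
    obtain ⟨D', h1, h2⟩ := (D n).exists_precomp_table (q := 4) (k := 1 + c n)
      (τ := fun U (k : Fin (Q.eval n)) =>
        if k < t then E.pairRow n ((b k).1 • E.origin n) ((b k).2 • E.origin n) else
        if k = t then Fin.append (U 2) (U 3) else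
          Fin.append (E.canon n (a k • E.origin n)) (T n (a k) (U 1))) (by
        intro B U hB hU k
        split_ifs
        · exact (Comp.const hB _).mono_size (Nat.le_add_right _ _)
        · exact (Comp.of_mem ((hU 2).append (hU 3))).mono_size (Nat.zero_le _)
        · refine (Comp.const hB (E.canon n (a k • E.origin n))).bind fun B' hB' h1 => ?_
          refine (hTc n (a k) B' _ (hB' hB) ((hU 1).mono hB')).bind (k' := 0)
            fun B'' hB'' h2 => ?_
          exact .of_mem ((h1.mono hB'').append h2))
    refine ⟨D', h1, fun g₀ u v => ?_⟩
    rw [enc_four, h2]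
    congr 2
    funext k
    split_ifs
    · rfl
    · rfl
    · simp only [Matrix.cons_val_one, Matrix.cons_val_zero, hT, pairRow]
      rw [hcomm n g₀, mul_smul]
  choose D' hD' hacc using H
  have hQ := PolyBounded.eval Q
  obtain ⟨ε, hε, hε0, hb⟩ := h.uniform D' (hD.add (((hQ.mul ((PolyBounded.const 1).add hc)).add
    ((PolyBounded.const 4).mul (hQ.mul (E.sLen_poly.add E.sLen_poly)))).add (.const 5))) hD'
  refine (hε.polyBounded_mul hε0 hQ).of_le (fun n => abs_nonneg _) fun n => ?_
  have key := abs_expect_hybrid (q := Q.eval n)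
    (fun (c g : G n) => E.pairRow n (g • E.origin n) ((c * g) • E.origin n))
    (fun g : G n × G n => E.pairRow n (g.1 • E.origin n) (g.2 • E.origin n))
    (fun s => (D n).accept (flat s)) (ε := ε n)
    (fun t a b => by
      have := hb n (t, a, b)
      simp only [hacc, expect_prod] at this
      simpa only [expect_prod] using this)
  simp only [enc_pairs]
  rw [expect_prod]
  convert key using 3
  exact (Fintype.expect_equiv (Equiv.arrowProdEquivProdArrow _ _ _) _ _ fun _ => rfl).symm

theorem nonempty_S (E : EGA G S) (n : ℕ) : Nonempty (S n) := ⟨E.origin n⟩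

variable [∀ n, Fintype (S n)]

/-- Pseudorandomness for polynomially many samples. -/
theorem PR.multi (h : E.PR) {q : ℕ → ℕ} (hq : PolyBounded q) :
    CompIndist (fun n (g : Fin (q n) → G n) => flat fun i => E.canon n (g i • E.origin n))
      (fun n (s : Fin (q n) → S n) => flat fun i => E.canon n (s i)) := by
  intro D hD
  have H : ∀ n (i : Fin (q n) × (Fin (q n) → G n) × (Fin (q n) → S n)), ∃ D' : Distinguisher,
      D'.size ≤ (D n).size + (q n * 1 + 4 * (q n * E.sLen n) + 5) ∧
      ∀ s : S n, D'.accept (E.enc n [E.origin n, s]) = (D n).accept (flat fun k =>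
        E.canon n (if k < i.1 then i.2.2 k else if k = i.1 then s else
          i.2.1 k • E.origin n)) := by
    rintro n ⟨t, a, b⟩
    obtain ⟨D', h1, h2⟩ := (D n).exists_precomp_table (q := 2) (k := 1)
      (τ := fun T (k : Fin (q n)) => if k < t then E.canon n (b k) else if k = t then T 1 else
        E.canon n (a k • E.origin n)) (by
        intro B T hB hT k
        split_ifs
        · exact .const hB _
        · exact (Comp.of_mem (hT 1)).mono_size zero_le_one
        · exact .const hB _)
    refine ⟨D', h1, fun s => ?_⟩
    rw [enc_pair, h2]
    congr 2
    funext k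
    split_ifs <;> rfl
  choose D' hD' hacc using H
  obtain ⟨ε, hε, hε0, hb⟩ := h.uniform D' (hD.add (((hq.mul (.const 1)).add
    ((PolyBounded.const 4).mul (hq.mul E.sLen_poly))).add (.const 5))) hD'
  refine (hε.polyBounded_mul hε0 hq).of_le (fun n => abs_nonneg _) fun n => ?_
  have := E.nonempty_S n
  have key := abs_expect_hybrid (C := Unit) (fun _ (g : G n) => g • E.origin n) (fun s : S n => s)
    (fun s : Fin (q n) → S n => (D n).accept (flat fun i => E.canon n (s i))) (ε := ε n)
    (fun t a b => by
      have := hb n (t, a, b)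
      simp only [hacc] at this
      simpa only [Fintype.expect_const] using this)
  simpa only [Fintype.expect_const] using key

/-- The distribution of `g • s` does not depend on `s`, by right translation in the group. Averaging
over `s` gives the uniform distribution, since each `g` permutes the set. -/
theorem PR.of_isPretransitive (h : ∀ n, MulAction.IsPretransitive (G n) (S n)) : E.PR := by
  intro D _
  have H : ∀ n (F : S n → ℝ), 𝔼 g : G n, F (g • E.origin n) = 𝔼 s, F s := by
    intro n F
    have := E.nonempty_S n
    have h1 : ∀ s : S n, 𝔼 g : G n, F (g • E.origin n) = 𝔼 g : G n, F (g • s) := by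
      intro s
      obtain ⟨k, hk⟩ := MulAction.exists_smul_eq (G n) s (E.origin n)
      exact Fintype.expect_equiv (Equiv.mulRight k) _ _ fun g => by simp [mul_smul, hk]
    calc 𝔼 g : G n, F (g • E.origin n)
        = 𝔼 s : S n, 𝔼 g : G n, F (g • s) := by
          simp only [← h1, Fintype.expect_const]
      _ = 𝔼 g : G n, 𝔼 s : S n, F (g • s) := Finset.expect_comm _ _ _
      _ = 𝔼 g : G n, 𝔼 s : S n, F s := Finset.expect_congr rfl fun g _ =>
          Fintype.expect_equiv (MulAction.toPerm g) _ _ fun s => rfl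
      _ = 𝔼 s, F s := Fintype.expect_const _
  have h0 : ∀ n, |(𝔼 g : G n, (D n).accept (E.enc n [E.origin n, g • E.origin n])) -
      𝔼 s : S n, (D n).accept (E.enc n [E.origin n, s])| = 0 := fun n => by
    rw [H n fun s => (D n).accept (E.enc n [E.origin n, s]), sub_self, abs_zero]
  simp only [h0]
  exact Asymptotics.superpolynomialDecay_zero _ _

/-- The chain of samples is `(g_i • s₀, (k * g_i) • s₀)`, `(s_i, k • s_i)`, `(s_i, s_i')`, `(g_i •
s₀, s_i')`, `(g_i • s₀, h_i • s₀)`. The second link is wPR; the others are PR for many samples, with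
the other random choices fixed in the circuit. -/
theorem NR.of_WPR (hPR : E.PR) (hW : E.WPR) : E.NR := by
  intro Q D hD
  have hQ := PolyBounded.eval Q
  obtain ⟨c, T, hc, hT, hTc⟩ := E.exists_actBits
  have H1 : ∀ n (g : G n), ∃ D' : Distinguisher, D'.size ≤ (D n).size + (Q.eval n * c n +
        4 * (Q.eval n * (E.sLen n + E.sLen n)) + 5) ∧
      ∀ s : Fin (Q.eval n) → S n, D'.accept (flat fun i => E.canon n (s i)) =
        (D n).accept (flat fun i => E.pairRow n (s i) (g • s i)) := by
    intro n g
    obtain ⟨D', h1, h2⟩ := (D n).exists_precomp_table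
      (τ := fun U (k : Fin (Q.eval n)) => Fin.append (U k) (T n g (U k))) (fun B U hB hU k =>
        (hTc n g B _ hB (hU k)).bind (k' := 0) fun B' hB' h2 =>
          .of_mem (((hU k).mono hB').append h2))
    refine ⟨D', h1, fun s => ?_⟩
    rw [h2]
    simp only [hT, pairRow]
  have H2 : ∀ n (s' : Fin (Q.eval n) → S n), ∃ D' : Distinguisher, D'.size ≤ (D n).size +
        (Q.eval n * 1 + 4 * (Q.eval n * (E.sLen n + E.sLen n)) + 5) ∧
      ∀ s : Fin (Q.eval n) → S n, D'.accept (flat fun i => E.canon n (s i)) =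
        (D n).accept (flat fun i => E.pairRow n (s i) (s' i)) := by
    intro n s'
    obtain ⟨D', h1, h2⟩ := (D n).exists_precomp_table
      (τ := fun U (k : Fin (Q.eval n)) => Fin.append (U k) (E.canon n (s' k)))
      (fun B U hB hU k => (Comp.const hB (E.canon n (s' k))).bind (k' := 0) fun B' hB' h2 =>
          .of_mem (((hU k).mono hB').append h2))
    exact ⟨D', h1, fun s => h2 _⟩
  have H3 : ∀ n (s' : Fin (Q.eval n) → G n), ∃ D' : Distinguisher, D'.size ≤ (D n).size +
        (Q.eval n * 1 + 4 * (Q.eval n * (E.sLen n + E.sLen n)) + 5) ∧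
      ∀ s : Fin (Q.eval n) → S n, D'.accept (flat fun i => E.canon n (s i)) =
        (D n).accept (flat fun i => E.pairRow n (s' i • E.origin n) (s i)) := by
    intro n s'
    obtain ⟨D', h1, h2⟩ := (D n).exists_precomp_table
      (τ := fun U (k : Fin (Q.eval n)) => Fin.append (E.canon n (s' k • E.origin n)) (U k))
      (fun B U hB hU k => (Comp.const hB (E.canon n (s' k • E.origin n))).bind (k' := 0)
        fun B' hB' h2 => .of_mem (h2.append ((hU k).mono hB')))
    exact ⟨D', h1, fun s => h2 _⟩
  choose D1 hD1 hacc1 using H1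
  choose D2 hD2 hacc2 using H2
  choose D3 hD3 hacc3 using H3
  have hs := (PolyBounded.const 4).mul (hQ.mul (E.sLen_poly.add E.sLen_poly))
  obtain ⟨ε₁, hε₁, -, hb1⟩ := (hPR.multi hQ).uniform D1
    (hD.add (((hQ.mul hc).add hs).add (.const 5))) hD1
  obtain ⟨ε₂, hε₂, -, hb2⟩ := (hPR.multi hQ).uniform D2
    (hD.add (((hQ.mul (.const 1)).add hs).add (.const 5))) hD2
  obtain ⟨ε₃, hε₃, -, hb3⟩ := (hPR.multi hQ).uniform D3
    (hD.add (((hQ.mul (.const 1)).add hs).add (.const 5))) hD3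
  refine (((hε₁.add (hW Q D hD)).add hε₂).add hε₃).of_le (fun n => abs_nonneg _) fun n => ?_
  have := E.nonempty_S n
  simp only [enc_pairs, expect_prod]
  simp only [hacc1] at hb1
  simp only [hacc2] at hb2
  simp only [hacc3] at hb3
  have k1 := abs_expect_sub_le (hb1 n)
  have k2 := abs_expect_sub_le (hb2 n)
  have k3 := abs_expect_sub_le (hb3 n)
  have e (F : (Fin (Q.eval n) → S n) → (Fin (Q.eval n) → S n) → ℝ) :
      𝔼 s, 𝔼 s', F s s' = 𝔼 s', 𝔼 s, F s s' := Finset.expect_comm _ _ _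
  rw [Finset.expect_comm, e, abs_sub_comm] at k2
  rw [abs_sub_comm] at k3
  simp only [mul_smul]
  refine (abs_sub_le _ _ _).trans (add_le_add ((abs_sub_le _ _ _).trans (add_le_add
    ((abs_sub_le _ _ _).trans (add_le_add k1 le_rfl)) k2)) k3)

end EGA

/-! ### Prefixes of inputs and conditional iteration. -/

theorem mask_of_le {a j : ℕ} (h : a ≤ j) (x : Fin a → Bool) : mask j x = x := by
  funext i
  simp [mask, lt_of_lt_of_le i.2 h]

theorem mask_zero {a : ℕ} (x : Fin a → Bool) : mask 0 x = fun _ => false := by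
  funext i
  simp [mask]

theorem mask_succ_apply {a : ℕ} (j : Fin a) (x : Fin a → Bool) : mask (j + 1) x j = x j := by
  simp [mask]

theorem update_mask_succ {a : ℕ} (j : Fin a) (x : Fin a → Bool) :
    Function.update (mask (j + 1) x) j false = mask j x := by
  funext i
  by_cases h : i = j
  · subst h; simp [mask]
  · have : i.val ≠ j.val := fun e => h (Fin.ext e)
    have h2 : i.val < j.val + 1 ↔ i.val < j.val := by omega
    simp [mask, h, h2]

theorem mask_succ_of_eq_false {a : ℕ} (j : Fin a) {x : Fin a → Bool} (h : x j = false) :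
    mask (j + 1) x = mask j x := by
  rw [← update_mask_succ, Function.update_eq_self_iff.2]
  rw [mask_succ_apply, h]

theorem Comp.foldl_mux {X : Type*} {B : Set (X → Bool)} (hB : (fun _ => false) ∈ B) {a w c : ℕ}
    {x : X → Fin a → Bool} (hx : BitsIn B x) {F : Fin a → (Fin w → Bool) → Fin w → Bool}
    (hF : ∀ (B : Set (X → Bool)) (i : Fin a) (f : X → Fin w → Bool), (fun _ => false) ∈ B →
      BitsIn B f → Comp B c fun y => F i (f y)) (L : List (Fin a)) {s : X → Fin w → Bool}
    (hs : BitsIn B s) : Comp B (L.length * (c + w * 4)) fun y =>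
      L.foldl (fun s i => if x y i then F i s else s) (s y) := by
  induction L generalizing B s with
  | nil => simpa using Comp.of_mem hs
  | cons i L ih =>
    have h1 := (hF B i s hB hs).bind fun B' hB' h =>
      (Comp.mux (hB' (hx i)) h (hs.mono hB')).bind fun B'' hB'' h' =>
        ih (hB'' (hB' hB)) (hx.mono (hB'.trans hB'')) h'
    rw [Fintype.card_fin] at h1
    refine Comp.mono_size h1 (le_of_eq ?_)
    rw [List.length_cons]
    ring

namespace EGA

variable {G S : ℕ → Type*} [∀ n, Group (G n)] [∀ n, MulAction (G n) (S n)]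

/-! ### The Naor-Reingold function -/

/-- The factors of the Naor-Reingold function from position `j` on, applied to `s`. -/
def tailAct {n l : ℕ} (g : Fin l → G n) (j : ℕ) (x : Fin l → Bool) (s : S n) : S n :=
  ((List.finRange l).drop j).foldl (fun s i => g i ^ (x i).toNat • s) s

theorem tailAct_eq {n l : ℕ} (g : Fin l → G n) (j : Fin l) (x : Fin l → Bool) (s : S n) :
    tailAct g j x s = tailAct g (j + 1) x (g j ^ (x j).toNat • s) := by
  rw [tailAct, List.drop_eq_getElem_cons (by simp)]
  simp [tailAct]

theorem tailAct_of_le {n l j : ℕ} (h : l ≤ j) (g : Fin l → G n) (x : Fin l → Bool) (s : S n) :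
    tailAct g j x s = s := by
  rw [tailAct, List.drop_of_length_le (by simpa using h), List.foldl_nil]

/-- The factors after position `j` do not involve the key element at `j`, so this element can play
the role of the NR secret. -/
theorem tailAct_update {n l : ℕ} (g : Fin l → G n) (j : Fin l) (k : G n) (x : Fin l → Bool)
    (s : S n) : tailAct (Function.update g j k) j x s =
      tailAct g (j + 1) x (k ^ (x j).toNat • s) := by
  rw [tailAct_eq, Function.update_self, tailAct, tailAct]
  refine List.foldl_ext _ _ _ fun s i hi => ?_
  have : i ≠ j := by
    rintro rfl
    obtain ⟨t, ht, e⟩ := List.mem_drop_iff_getElem.1 hi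
    simp [Fin.ext_iff] at e
    omega
  rw [Function.update_of_ne this]

variable [∀ n, Fintype (G n)] (E : EGA G S)

theorem nrFun_cons {n l : ℕ} (g₀ : G n) (g : Fin l → G n) (x : Fin l → Bool) :
    E.nrFun n (Fin.cons g₀ g) x = tailAct g 0 x (g₀ • E.origin n) := by
  have h : ∀ (L : List (Fin l)) (s : S n), (L.map fun i => g i ^ (x i).toNat).reverse.prod • s =
      L.foldl (fun s i => g i ^ (x i).toNat • s) s := by
    intro L
    induction L with
    | nil => simp
    | cons i L ih =>
      intro s
      simp [← ih, mul_smul]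
  simp [nrFun, tailAct, ← h, mul_smul, List.ofFn_eq_map]

/-- The remaining factors of the Naor-Reingold function, applied to one of two given set elements,
are computed by circuits of polynomial size, uniformly in the key. -/
theorem exists_tailAct_bits : ∃ c : ℕ → ℕ, PolyBounded c ∧ ∀ n {l : ℕ} (g : Fin l → G n)
    (j : Fin l), ∃ Φ : (Fin l → Bool) → (Fin (E.sLen n + E.sLen n) → Bool) →
      Fin (E.sLen n) → Bool, BinaryComp (E.sLen n * 4 + l * (c n + E.sLen n * 4)) Φ ∧
      ∀ x s t, Φ x (E.pairRow n s t) =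
        E.canon n (tailAct g (j + 1) x (if x j then t else s)) := by
  obtain ⟨c, T, hc, hT, hTc⟩ := E.exists_actBits
  refine ⟨c, hc, fun n l g j => ⟨fun x r => ((List.finRange l).drop (j + 1)).foldl
    (fun s i => if x i then T n (g i) s else s)
    (if x j then fun k => r (Fin.natAdd _ k) else fun k => r (Fin.castAdd _ k)), ?_, ?_⟩⟩
  · intro B x r hB hx hr
    have h1 := (Comp.mux (hx j) (f := fun c k => r c (Fin.natAdd _ k))
      (g := fun c k => r c (Fin.castAdd _ k)) (fun k => hr _) (fun k => hr _)).bind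
      fun B' hB' h => Comp.foldl_mux (hB' hB) (hx.mono hB')
        (fun B i f hB hf => hTc n (g i) B f hB hf) ((List.finRange l).drop (j + 1)) h
    rw [Fintype.card_fin] at h1
    refine h1.mono_size (Nat.add_le_add_left (Nat.mul_le_mul_right _ ?_) _)
    simp
  · intro x s t
    have h : ∀ (L : List (Fin l)) (s : S n),
        L.foldl (fun s i => if x i then T n (g i) s else s) (E.canon n s) =
          E.canon n (L.foldl (fun s i => g i ^ (x i).toNat • s) s) := by
      intro L
      induction L with
      | nil => simp
      | cons i L ih =>
        intro s
        rw [List.foldl_cons, List.foldl_cons, ← ih]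
        cases x i <;> simp [hT]
    have h1 : (fun k => E.pairRow n s t (Fin.natAdd _ k)) = E.canon n t :=
      funext fun k => Fin.append_right _ _ k
    have h2 : (fun k => E.pairRow n s t (Fin.castAdd _ k)) = E.canon n s :=
      funext fun k => Fin.append_left _ _ k
    rw [tailAct, ← h]
    simp only [h1, h2]
    split_ifs <;> rfl

theorem expect_nrFun {n l : ℕ} (F : ((Fin l → Bool) → S n) → ℝ) :
    𝔼 g : Fin (l + 1) → G n, F (E.nrFun n g) = 𝔼 g : Fin l → G n,
      𝔼 R : (Fin l → Bool) → G n,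
        F fun x => tailAct g 0 x (R (mask 0 x) • E.origin n) := by
  rw [expect_cons, Finset.expect_comm]
  refine Finset.expect_congr rfl fun g _ => ?_
  have h1 : (fun x : G n => F (E.nrFun n (Fin.cons x g))) = fun x =>
      F fun y => tailAct g 0 y (x • E.origin n) := by
    funext x
    congr 1
    funext y
    exact E.nrFun_cons x g y
  rw [h1]
  simp only [mask_zero]
  have h2 := expect_comp_injective (V := G n) (f := fun _ : Unit => fun _ : Fin l => false)
    (fun _ _ _ => rfl) (fun R => F fun y => tailAct g 0 y (R () • E.origin n))
  refine Eq.trans ?_ h2.symm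
  exact (Fintype.expect_equiv (Equiv.funUnique Unit (G n)) _ _ fun _ => rfl).symm

/-- A random function of the first `j + 1` bits is a pair of independent random functions of the
first `j` bits, selected by the bit `x j`. -/
theorem expect_split {n l : ℕ} (j : Fin l) (F : ((Fin l → Bool) → G n) → ℝ) :
    𝔼 R : (Fin l → Bool) → G n, F (fun x => R (mask (j + 1) x)) =
      𝔼 R : (Fin l → Bool) → G n × G n,
        F fun x => if x j then (R (mask j x)).2 else (R (mask j x)).1 := by
  -- The summand records the bit at `j`, which is then cleared. Being injective, `f` pulls a uniform
  -- function on the sum back to a uniform function.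
  let f : (Fin l → Bool) → (Fin l → Bool) ⊕ (Fin l → Bool) := fun y =>
    if y j then .inr (Function.update y j false) else .inl y
  have hf : f.Injective := by
    intro y z h
    cases hy : y j <;> cases hz : z j <;> simp only [f, hy, hz] at h
    · simpa using h
    · simp at h
    · simp at h
    · simp only [if_true, Sum.inr.injEq] at h
      funext i
      by_cases hi : i = j
      · rw [hi, hy, hz]
      · simpa [hi] using congrFun h i
  rw [← expect_comp_injective hf fun R => F fun x => R (mask (j + 1) x)]
  refine Fintype.expect_equiv ((Equiv.sumArrowEquivProdArrow _ _ _).trans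
    (Equiv.arrowProdEquivProdArrow _ (fun _ => G n) fun _ => G n).symm) _ _ fun R => ?_
  congr 1
  funext x
  simp only [Function.comp, f, mask_succ_apply, update_mask_succ]
  cases hx : x j
  · simp [mask_succ_of_eq_false j hx]
  · simp

variable {E} [∀ n, Fintype (S n)]

theorem IsPRF.of_NR (hPR : E.PR) (hNR : E.NR) {l : ℕ → ℕ} (hl : PolyBounded l) : E.IsPRF l := by
  rintro A ⟨Q, hQ⟩
  have hQp := PolyBounded.eval Q
  have hs := E.sLen_poly
  obtain ⟨c, hc, hΦ⟩ := E.exists_tailAct_bits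
  have hcost {b w k : ℕ → ℕ} (hb : PolyBounded b) (hw : PolyBounded w) (hk : PolyBounded k) :
      PolyBounded fun n => Q.eval n +
        (Q.eval n * simCost (Q.eval n) (l n) (b n) (w n) (k n) + 2) := by
    unfold simCost
    exact hQp.add ((hQp.mul ((((((hQp.mul (((hl.mul (.const 7)).add (.const 1)).add
      (hw.mul (.const 4)))).add hk).add (.const 6)).add ((PolyBounded.const 4).mul hl)).add
      ((PolyBounded.const 4).mul hb)).add (.const 1))).add (.const 2))
  -- For fixed position and key, one distinguisher links both hybrids: NR samples with secret `k`
  -- produce hybrid `j` with `k` as key element at `j`, and independent pairs produce hybrid `j +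
  -- 1`.
  have hstep : ∀ n (i : Fin (l n) × (Fin (l n) → G n)), ∃ D : Distinguisher,
      D.size ≤ Q.eval n + (Q.eval n * simCost (Q.eval n) (l n) (E.sLen n) (E.sLen n + E.sLen n)
        (E.sLen n * 4 + l n * (c n + E.sLen n * 4)) + 2) ∧
      (∀ k : G n, 𝔼 v : Fin (Q.eval n) → G n,
          D.accept (flat fun i => E.pairRow n (v i • E.origin n) ((k * v i) • E.origin n)) =
        𝔼 R : (Fin (l n) → Bool) → G n, (A n).accept fun x => E.canon n
          (tailAct (Function.update i.2 i.1 k) i.1 x (R (mask i.1 x) • E.origin n))) ∧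
      𝔼 v : Fin (Q.eval n) → G n × G n,
          D.accept (flat fun i => E.pairRow n ((v i).1 • E.origin n) ((v i).2 • E.origin n)) =
        𝔼 R : (Fin (l n) → Bool) → G n, (A n).accept fun x => E.canon n
          (tailAct i.2 (i.1 + 1) x (R (mask (i.1 + 1) x) • E.origin n)) := by
    rintro n ⟨j, g⟩
    obtain ⟨Φ, hΦc, hΦe⟩ := hΦ n g j
    obtain ⟨D, h1, h2⟩ := (A n).exists_sim hΦc j (hQ n)
    refine ⟨D, h1, fun k => ?_, ?_⟩
    · simp only [h2]
      rw [expect_lazyAccept j Φ (fun v : G n => E.pairRow n (v • E.origin n)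
        ((k * v) • E.origin n)) (A n) (hQ n)]
      simp only [hΦe, tailAct_update]
      refine Finset.expect_congr rfl fun R _ => ?_
      congr 1
      funext x
      cases x j <;> simp [mul_smul]
    · simp only [h2]
      rw [expect_lazyAccept j Φ (fun v : G n × G n => E.pairRow n (v.1 • E.origin n)
        (v.2 • E.origin n)) (A n) (hQ n), expect_split j fun R => (A n).accept fun x =>
        E.canon n (tailAct g (j + 1) x (R x • E.origin n))]
      simp only [hΦe]
      refine Finset.expect_congr rfl fun R _ => ?_
      congr 1
      funext x
      cases x j <;> simp
  choose D hD hDreal hDrand using hstep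
  obtain ⟨ε, hε, hε0, hb⟩ := (hNR Q).uniform D (hcost hs (hs.add hs)
    ((hs.mul (.const 4)).add (hl.mul (hc.add (hs.mul (.const 4)))))) hD
  -- In the last hybrid the mask keeps all bits and no factor remains, so the rows of the table are
  -- themselves the answers.
  have hlast := fun n => (A n).exists_sim (b := E.sLen n) (w := E.sLen n) (Φ := fun _ t => t)
    (k := 0) (fun B x t _ _ ht => .of_mem ht) (l n) (hQ n)
  choose D' hD' hacc' using hlast
  refine ((hε.polyBounded_mul hε0 hl).add (hPR.multi hQp D' ((hcost hs hs (.const 0)).of_le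
    hD'))).of_le (fun n => abs_nonneg _) fun n => ?_
  have := E.nonempty_S n
  let H : ℕ → ℝ := fun j => 𝔼 g : Fin (l n) → G n, 𝔼 R : (Fin (l n) → Bool) → G n,
    (A n).accept fun x => E.canon n (tailAct g j x (R (mask j x) • E.origin n))
  have hH : ∀ j < l n, |H j - H (j + 1)| ≤ ε n := by
    intro j hj
    -- Resampling the key element at `j` separates the secret `k` from the key `g`, which can then
    -- be fixed.
    have e : H j = 𝔼 g : Fin (l n) → G n, 𝔼 k : G n, 𝔼 R : (Fin (l n) → Bool) → G n,
        (A n).accept fun x => E.canon n (tailAct (Function.update g ⟨j, hj⟩ k) j x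
          (R (mask j x) • E.origin n)) := by
      rw [Finset.expect_comm]
      exact expect_eq_expect_update ⟨j, hj⟩ fun g : Fin (l n) → G n =>
        𝔼 R : (Fin (l n) → Bool) → G n,
          (A n).accept fun x => E.canon n (tailAct g j x (R (mask j x) • E.origin n))
    rw [e]
    refine abs_expect_sub_le fun g => ?_
    have h1 := hb n (⟨j, hj⟩, g)
    simp only [enc_pairs] at h1
    rw [expect_prod] at h1
    simp only [hDreal] at h1
    rw [← hDrand n (⟨j, hj⟩, g)]
    convert h1 using 3
    exact Fintype.expect_equiv (Equiv.arrowProdEquivProdArrow _ _ _) _ _ fun _ => rfl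
  have hsum : |H 0 - H (l n)| ≤ l n * ε n := by
    rw [← Finset.sum_range_sub' H (l n)]
    refine (Finset.abs_sum_le_sum_abs _ _).trans ((Finset.sum_le_sum fun t ht =>
      hH t (Finset.mem_range.1 ht)).trans ?_)
    simp
  have hfinal : H (l n) = 𝔼 v : Fin (Q.eval n) → G n,
      (D' n).accept (flat fun i => E.canon n (v i • E.origin n)) := by
    simp only [hacc', H, tailAct_of_le le_rfl, Fintype.expect_const]
    rw [expect_lazyAccept (l n) (fun _ t => t) (fun v : G n => E.canon n (v • E.origin n)) (A n)
      (hQ n)]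
  have hrand : 𝔼 f : (Fin (l n) → Bool) → S n, (A n).accept (fun x => E.canon n (f x)) =
      𝔼 v : Fin (Q.eval n) → S n, (D' n).accept (flat fun i => E.canon n (v i)) := by
    simp only [hacc']
    rw [expect_lazyAccept (l n) (fun _ t => t) (fun v : S n => E.canon n v) (A n) (hQ n)]
    simp only [mask_of_le le_rfl]
  have hreal : 𝔼 g : Fin (l n + 1) → G n, (A n).accept (fun x => E.canon n (E.nrFun n g x)) =
      H 0 := E.expect_nrFun fun f => (A n).accept fun x => E.canon n (f x)
  rw [hreal, hrand, ← hfinal]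
  exact (abs_sub_le _ (H (l n)) _).trans (add_le_add hsum le_rfl)

end EGA

end NRPRF

theorem theoremB1 {G : ℕ → Type*} {S : ℕ → Type*} [∀ n, Group (G n)]
    [∀ n, MulAction (G n) (S n)] [∀ n, Fintype (G n)] [∀ n, Fintype (S n)]
    (E : EGA G S) (l : ℕ → ℕ) (hl : PolyBounded l) :
    (E.PR → E.NR → E.IsPRF l) ∧
    ((∀ n (g h : G n), g * h = h * g) → E.PR → E.DDH → E.IsPRF l) ∧
    (E.PR → E.WPR → E.IsPRF l) ∧
    ((∀ n, MulAction.IsPretransitive (G n) (S n)) → (∀ n, FaithfulSMul (G n) (S n)) →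
      E.WPR → E.IsPRF l) :=
  ⟨fun hPR hNR => .of_NR hPR hNR hl,
    fun hcomm hPR hDDH => .of_NR hPR (.of_DDH hcomm hDDH) hl,
    fun hPR hW => .of_NR hPR (.of_WPR hPR hW) hl,
    fun htrans _ hW => .of_NR (.of_isPretransitive htrans)
      (.of_WPR (.of_isPretransitive htrans) hW) hl⟩
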